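/- **Lemma 3.6 (commutator-type estimate).** Let $n\ge 2$, and let either $\Omega=\mathbb R^n$ or $\Omega\subset\mathbb R^n$ be a bounded open set with Lipschitz boundary. For $u\in BV(\mathbb R^n)$ (real valued) and $\lambda>0$ let $$\mathcal O_\lambda=\{\mathcal M(Du)>\lambda\},\qquad \mathcal M(Du)(x)=\sup_{Q\ni x}\frac{|Du|(Q)}{\ell(Q)^n},$$ the supremum being over axis-parallel cubes $Q$ of side length $\ell(Q)>0$. Let $(Q_j)_j$ be a countable (possibly empty) Whitney cover of $\mathcal O_\lambda$ by open axis-parallel cubes of side lengths $r_j>0$ ($tQ_j$ is the concentric cube of side $t r_j$): * (W1) $\bigcup_j\frac12Q_j=\mathcal O_\lambda$; * (W2) $8Q_j\subset\mathcal O_\lambda$ and $16Q_j\cap(\mathbb R^n\setminus\mathcal O_\lambda)\ne\emptyset$; * (W3) if $Q_j\cap Q_k\neq\emptyset$, then $\frac12r_k\le r_j\le 2r_k$; * (W4) $\frac14Q_j\cap\frac14Q_k=\emptyset$ for $j\ne k$; * (W5) every point lies in at most $120^n$ of the cubes $4Q_j$. Let $(\eta_j)_j\subset C_c^\infty(\mathbb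 R^n)$ satisfy $0\le\eta_j\le \mathbf 1_{\frac34Q_j}$, $\sum_j\eta_j=1$ on $\mathcal O_\lambda$ and $\|\eta_j\|_\infty+r_j\|\nabla\eta_j\|_\infty+r_j^2\|\nabla^2\eta_j\|_\infty\le K$ for all $j$. Let $h:(0,\infty)\to(0,1]$ be non-increasing with $\lim_{\lambda\to\infty}h(\lambda)=0$, let $\phi\ge0$ be a smooth, radially symmetric function with support in the unit ball and $\int\phi=1$, and put $\phi_j(x)=\epsilon_j^{-n}\phi(x/\epsilon_j)$ with $\epsilon_j=\frac14h(\lambda)r_j$. Let $u_j$ be the mean value of $u$ over $Q_j$ if $\frac34Q_j\subset\Omega$, and $u_j=0$ otherwise. Define $$T_\lambda u=u-\sum_j\Big(\eta_j(u-u_j)-\phi_j*(\eta_j(u-u_j))\Big),\qquad S_\lambda\rho=\rho-\sum_j\eta_j(\rho-\phi_j*\rho).$$ 1. For every $\rho\in C_c(\Omega;\mathbb R^n)$ we have $\|S_\lambda\rho\|_\infty\le\|\rho\|_\infty$. 2. If $u=0$ a.e. on $\mathbb R^n\setminus\Omega$ (no condition when $\Omega=\mathbb R^n$), then $T_\lambda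 u\in BV(\mathbb R^n)$, and for every $\rho\in C_c(\Omega;\mathbb R^n)$ $$\big|\langle DT_\lambda u,\rho\rangle-\langle Du,S_\lambda\rho\rangle\big|\le c\,h(\lambda)\,|Du|(\mathcal O_\lambda)\,\|\rho\|_\infty .$$ Here $\langle\mu,\rho\rangle=\int\rho\cdot d\mu$, and the constant $c>0$ depends only on $n$, $\Omega$ and $K$; in particular it does not depend on $\phi$, $h$, $\lambda$, $u$, $\rho$, the cover or the partition. -/

import Mathlib

open MeasureTheory Set Filter Topology
open scoped ENNReal Convolution

noncomputable section

namespace LipTrunc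

/-- `ℝⁿ` with the Euclidean norm. -/
abbrev E (n : ℕ) : Type := EuclideanSpace ℝ (Fin n)

/-! ### Functions of bounded variation on the whole space -/

/-- The divergence of a vector field. -/
def divergence {n : ℕ} (ψ : E n → E n) (x : E n) : ℝ :=
  ∑ i : Fin n, fderiv ℝ ψ x (EuclideanSpace.single i 1) i

/-- `u ∈ BV(ℝⁿ)`: `u` is integrable and
`sup {∫ u div ψ : ψ ∈ C¹_c(ℝⁿ; ℝⁿ), |ψ| ≤ 1} < ∞`. -/
def IsBV {n : ℕ} (u : E n → ℝ) : Prop :=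
  Integrable u ∧
    BddAbove {t : ℝ | ∃ ψ : E n → E n, ContDiff ℝ 1 ψ ∧ HasCompactSupport ψ ∧
      (∀ x, ‖ψ x‖ ≤ 1) ∧ t = ∫ x, u x * divergence ψ x}

/-- The pairing `⟨μ, ρ⟩ = ∫ ρ · dμ` of an `ℝⁿ`-valued measure with a vector field. -/
def pairing {n : ℕ} (μ : VectorMeasure (E n) (E n)) (ρ : E n → E n) : ℝ :=
  ∫ᵛ x, ρ x ∂[innerSL ℝ; μ]

/-- The `ℝⁿ`-valued measure `μ` is the distributional gradient of `u`. -/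
def IsDistribGrad {n : ℕ} (u : E n → ℝ) (μ : VectorMeasure (E n) (E n)) : Prop :=
  ∀ ψ : E n → E n, ContDiff ℝ 1 ψ → HasCompactSupport ψ →
    pairing μ ψ = -∫ x, u x * divergence ψ x

open Classical in
/-- The measure `Du` (every function of bounded variation has exactly one distributional gradient;
the value is `0` for functions that have none). -/
def D {n : ℕ} (u : E n → ℝ) : VectorMeasure (E n) (E n) :=
  if h : ∃ μ, IsDistribGrad u μ then h.choose else 0

/-! ### Cubes, maximal function and bad set -/

/-- The open cube with centre `a` and side length `s`, with sides parallel to the axes. -/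
def cube {n : ℕ} (a : E n) (s : ℝ) : Set (E n) := {x | ∀ i, |x i - a i| < s / 2}

/-- The maximal function `ℳμ(x) = sup_{Q ∋ x} |μ|(Q) / ℓ(Q)ⁿ`, where `|μ|` is the total variation
measure. By inner exhaustion and outer approximation of cubes the supremum is the same over
open and over closed cubes. -/
def maximal {n : ℕ} (μ : VectorMeasure (E n) (E n)) (x : E n) : ℝ≥0∞ :=
  ⨆ (a : E n) (s : ℝ) (_ : 0 < s) (_ : x ∈ cube a s), μ.variation (cube a s) / ENNReal.ofReal (s ^ n)

/-- The bad set `𝒪_λ = {ℳ(Du) > λ}`. -/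
def badSet {n : ℕ} (u : E n → ℝ) (lam : ℝ) : Set (E n) :=
  {x | ENNReal.ofReal lam < maximal (D u) x}

/-! ### Whitney covers and partitions of unity -/

/-- The cubes `Q_j` with centres `a j` and side lengths `r j` form a Whitney cover of `O`;
the cube `t Q_j` is `cube (a j) (t * r j)`. -/
structure IsWhitneyCover {n : ℕ} (O : Set (E n)) {ι : Type} (a : ι → E n) (r : ι → ℝ) : Prop where
  pos : ∀ j, 0 < r j
  half_cover : ⋃ j, cube (a j) (1 / 2 * r j) = O
  eight_subset : ∀ j, cube (a j) (8 * r j) ⊆ O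
  sixteen_meets : ∀ j, (cube (a j) (16 * r j) ∩ Oᶜ).Nonempty
  comparable : ∀ j k, (cube (a j) (r j) ∩ cube (a k) (r k)).Nonempty →
    1 / 2 * r k ≤ r j ∧ r j ≤ 2 * r k
  quarter_disjoint : ∀ j k, j ≠ k →
    Disjoint (cube (a j) (1 / 4 * r j)) (cube (a k) (1 / 4 * r k))
  overlap : ∀ x, {j | x ∈ cube (a j) (4 * r j)}.encard ≤ ((120 ^ n : ℕ) : ℕ∞)

/-- The functions `η_j` form a smooth partition of unity on `O` subordinate to the cubes
`(3/4) Q_j`, with `‖η_j‖_∞ + r_j ‖∇η_j‖_∞ + r_j² ‖∇²η_j‖_∞ ≤ K`. -/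
structure IsWhitneyPartition {n : ℕ} (K : ℝ) (O : Set (E n)) {ι : Type} (a : ι → E n) (r : ι → ℝ)
    (η : ι → E n → ℝ) : Prop where
  smooth : ∀ j, ContDiff ℝ ((⊤ : ℕ∞) : WithTop ℕ∞) (η j)
  nonneg : ∀ j x, 0 ≤ η j x
  le_indicator : ∀ j x, η j x ≤ (cube (a j) (3 / 4 * r j)).indicator (fun _ => (1 : ℝ)) x
  deriv_bound : ∀ j x y z,
    |η j x| + r j * ‖fderiv ℝ (η j) y‖ + r j ^ 2 * ‖iteratedFDeriv ℝ 2 (η j) z‖ ≤ K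
  sum_eq_one : ∀ x ∈ O, HasSum (fun j => η j x) 1

/-! ### Mollifiers -/

/-- A smooth, non-negative, radially symmetric mollifier with support in the unit ball. -/
structure IsMollifier {n : ℕ} (φ : E n → ℝ) : Prop where
  smooth : ContDiff ℝ ((⊤ : ℕ∞) : WithTop ℕ∞) φ
  nonneg : ∀ x, 0 ≤ φ x
  radial : ∀ x y, ‖x‖ = ‖y‖ → φ x = φ y
  tsupport_subset : tsupport φ ⊆ Metric.closedBall 0 1
  integral_eq_one : ∫ x, φ x = 1

/-- `x ↦ ε⁻ⁿ φ(x/ε)`. -/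
def rescale {n : ℕ} (φ : E n → ℝ) (ε : ℝ) (x : E n) : ℝ := (ε ^ n)⁻¹ * φ (ε⁻¹ • x)

/-- The mollification `φ_j ∗ g` at a cube of side length `rj`: the mollifier has
radius `ε_j = h(λ) r_j / 4`, where `t` stands for `h(λ)`. -/
def mollify {n : ℕ} {F : Type} [NormedAddCommGroup F] [NormedSpace ℝ F]
    (φ : E n → ℝ) (t rj : ℝ) (g : E n → F) : E n → F :=
  rescale φ (t * (1 / 4) * rj) ⋆[ContinuousLinearMap.lsmul ℝ ℝ, volume] g

/-! ### The truncation operator and its almost dual -/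

open Classical in
/-- The number `u_j`: the mean of `u` over the cube `Q_j` with centre `aj` and side length `rj`
if `(3/4) Q_j ⊆ Ω`, and `0` otherwise. -/
def localMean {n : ℕ} (Ω : Set (E n)) (u : E n → ℝ) (aj : E n) (rj : ℝ) : ℝ :=
  if cube aj (3 / 4 * rj) ⊆ Ω then ⨍ x in cube aj rj, u x else 0

/-- `ℬ_j u = η_j (u - u_j) - φ_j ∗ (η_j (u - u_j))`. -/
def localCorrection {n : ℕ} (Ω : Set (E n)) (φ : E n → ℝ) (t : ℝ) (aj : E n) (rj : ℝ)
    (ηj : E n → ℝ) (u : E n → ℝ) (x : E n) : ℝ :=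
  ηj x * (u x - localMean Ω u aj rj)
    - mollify φ t rj (fun y => ηj y * (u y - localMean Ω u aj rj)) x

/-- `T_λ u = u - ∑_j ℬ_j u`, where `t` stands for `h(λ)`. For a Whitney cover
the sum has only finitely many non-zero terms at every point. -/
def truncation {n : ℕ} (Ω : Set (E n)) (φ : E n → ℝ) (t : ℝ) {ι : Type} (a : ι → E n) (r : ι → ℝ)
    (η : ι → E n → ℝ) (u : E n → ℝ) (x : E n) : ℝ :=
  u x - ∑' j, localCorrection Ω φ t (a j) (r j) (η j) u x

/-- `S_λ ρ = ρ - ∑_j η_j (ρ - φ_j ∗ ρ)`, where `t` stands for `h(λ)`. For a Whitney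
cover the sum has only finitely many non-zero terms at every point. -/
def almostDual {n : ℕ} (φ : E n → ℝ) (t : ℝ) {ι : Type} (r : ι → ℝ)
    (η : ι → E n → ℝ) (ρ : E n → E n) (x : E n) : E n :=
  ρ x - ∑' j, η j x • (ρ x - mollify φ t (r j) ρ x)

/-! ### Domains -/

/-- `Ω` is open and bounded with Lipschitz boundary: near every boundary point it is,
in suitable orthonormal coordinates, the set above the graph of a Lipschitz function. The function
`γ` is only evaluated on the hyperplane orthogonal to the unit vector `ν`. -/
def IsBoundedLipschitz {n : ℕ} (Ω : Set (E n)) : Prop :=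
  IsOpen Ω ∧ Bornology.IsBounded Ω ∧
    ∀ x ∈ frontier Ω, ∃ R > 0, ∃ ν : E n, ‖ν‖ = 1 ∧ ∃ (L : NNReal) (γ : E n → ℝ),
      LipschitzWith L γ ∧
      ∀ y ∈ Metric.ball x R, y ∈ Ω ↔ γ (y - (inner ℝ ν y) • ν) < inner ℝ ν y

end LipTrunc

end

/-! Write `t = h(λ)`, `ε_j = t r_j / 4` and `B_j u` for the local correction. The first claim holds
because on `𝒪_λ` the field `S_λ ρ` equals `∑ η_j (φ_j ∗ ρ)`, a convex combination of averages of
`ρ`, and off `𝒪_λ` it is `ρ` itself (`norm_almostDual_le`).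

For the second claim, test with a `C¹` field `ψ`. Since `φ_j` is even, convolution with it is
self-adjoint and can be moved onto `div ψ`. The product rule then gives `∫ B_j u div ψ = -⟨Du, η_j
(ψ - φ_j ∗ ψ)⟩ - e_j` with `e_j = ∫ (u - u_j) ∇η_j · (ψ - φ_j ∗ ψ)`
(`integral_correction_mul_divergence`). The pairings sum to `⟨Du, ψ - S_λ ψ⟩`, so `⟨DT_λ u, ψ⟩ -
⟨Du, S_λ ψ⟩` is exactly `-∑ e_j`.

To bound `e_j` by the sup norm of `ψ` alone, view `ψ - φ_j ∗ ψ` as an average of increments over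
shifts of length at most `ε_j`, apply a first order Taylor formula, and integrate the derivative of
`ψ` by parts onto `(u - u_j) ∇η_j` (`abs_integral_fderiv_cutoff_le`). This costs `ε_j (K/r_j
|Du|(Q_j) + K/r_j² ∫_{Q_j} |u - u_j|) ‖ψ‖_∞`. A Poincaré inequality bounds the last integral by a
multiple of `r_j |Du|(4Q_j)`, so all powers of `r_j` cancel and a factor `t` remains. The bounded
overlap of the cubes `4Q_j` sums this to `|Du|(𝒪_λ)`.

Poincaré must also hold when `u_j = 0`. Then `(3/4)Q_j` leaves `Ω`, the Lipschitz boundary provides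
a ball of comparable size in `Q_j \ Ω`, and `u` vanishes there, so `0` is a mean of `u` over a fixed
proportion of `Q_j` (`exists_localMean_eq_average`).

The estimate on `C¹` fields and the first claim show that `T_λ u` is of bounded variation; uniform
approximation then gives all continuous fields. That `D` really is a distributional gradient on `BV`
comes from Hahn–Banach and a Riesz theorem for signed functionals. The estimates hold for any
distributional gradient, so uniqueness plays no role. -/

namespace LipTrunc

open scoped NNReal BoundedContinuousFunction CompactlySupported

/-! ### Riesz representation of bounded signed functionals. -/

section Riesz

variable {X : Type*} [TopologicalSpace X]

/-- The values of a functional on continuous functions between `0` and `f`. -/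
def valuesBelow (L : (X →ᵇ ℝ) →L[ℝ] ℝ) (f : X →ᵇ ℝ) : Set ℝ :=
  {t | ∃ g : X →ᵇ ℝ, 0 ≤ g ∧ g ≤ f ∧ t = L g}

/-- The positive part of a functional, on nonnegative functions. -/
noncomputable def functionalPos (L : (X →ᵇ ℝ) →L[ℝ] ℝ) (f : X →ᵇ ℝ) : ℝ := sSup (valuesBelow L f)

lemma norm_le_norm_of_le {g f : X →ᵇ ℝ} (h0 : 0 ≤ g) (h : g ≤ f) : ‖g‖ ≤ ‖f‖ := by
  refine (BoundedContinuousFunction.norm_le (norm_nonneg _)).2 fun x => ?_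
  have h0x : 0 ≤ g x := h0 x
  rw [Real.norm_of_nonneg h0x]
  exact (h x).trans ((le_abs_self _).trans (f.norm_coe_le_norm x))

lemma functional_le_of_le (L : (X →ᵇ ℝ) →L[ℝ] ℝ) {g f : X →ᵇ ℝ} (h0 : 0 ≤ g) (h : g ≤ f) :
    L g ≤ ‖L‖ * ‖f‖ := by
  refine ((le_abs_self _).trans (L.le_opNorm g)).trans ?_
  gcongr
  exact norm_le_norm_of_le h0 h

lemma bddAbove_valuesBelow (L : (X →ᵇ ℝ) →L[ℝ] ℝ) (f : X →ᵇ ℝ) :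
    BddAbove (valuesBelow L f) := by
  refine ⟨‖L‖ * ‖f‖, ?_⟩
  rintro _ ⟨g, h0, h, rfl⟩
  exact functional_le_of_le L h0 h

lemma le_functionalPos (L : (X →ᵇ ℝ) →L[ℝ] ℝ) {g f : X →ᵇ ℝ} (h0 : 0 ≤ g) (h : g ≤ f) :
    L g ≤ functionalPos L f :=
  le_csSup (bddAbove_valuesBelow L f) ⟨g, h0, h, rfl⟩

lemma functionalPos_le (L : (X →ᵇ ℝ) →L[ℝ] ℝ) {f : X →ᵇ ℝ} (hf : 0 ≤ f) {C : ℝ}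
    (h : ∀ g : X →ᵇ ℝ, 0 ≤ g → g ≤ f → L g ≤ C) : functionalPos L f ≤ C := by
  refine csSup_le ⟨0, 0, le_rfl, hf, by simp⟩ ?_
  rintro _ ⟨g, h0, h1, rfl⟩
  exact h g h0 h1

lemma functionalPos_nonneg (L : (X →ᵇ ℝ) →L[ℝ] ℝ) {f : X →ᵇ ℝ} (hf : 0 ≤ f) :
    0 ≤ functionalPos L f := by
  simpa using le_functionalPos L le_rfl hf

/-- Subadditivity is Riesz decomposition: a competitor `g ≤ f₁ + f₂` splits into `g ⊓ f₁` and a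
remainder lying between `0` and `f₂`. For the converse, competitors are added. -/
lemma functionalPos_add (L : (X →ᵇ ℝ) →L[ℝ] ℝ) {f₁ f₂ : X →ᵇ ℝ} (h₁ : 0 ≤ f₁) (h₂ : 0 ≤ f₂) :
    functionalPos L (f₁ + f₂) = functionalPos L f₁ + functionalPos L f₂ := by
  apply le_antisymm
  · refine functionalPos_le L (add_nonneg h₁ h₂) fun g h0 h => ?_
    have e : g = g ⊓ f₁ + (g - g ⊓ f₁) := by abel
    rw [e, map_add]
    refine add_le_add (le_functionalPos L (le_inf h0 h₁) inf_le_right)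
      (le_functionalPos L (sub_nonneg.2 inf_le_left) ?_)
    intro x
    have hx : g x ≤ f₁ x + f₂ x := h x
    have hx2 : 0 ≤ f₂ x := h₂ x
    change g x - min (g x) (f₁ x) ≤ f₂ x
    rcases min_cases (g x) (f₁ x) with h | h <;> linarith
  · rw [← le_sub_iff_add_le]
    refine functionalPos_le L h₁ fun g h0 h => ?_
    rw [le_sub_comm]
    refine functionalPos_le L h₂ fun g' h0' h' => ?_
    rw [le_sub_iff_add_le', ← map_add]
    exact le_functionalPos L (add_nonneg h0 h0') (add_le_add h h')

lemma bounded_smul_nonneg {f : X →ᵇ ℝ} (hf : 0 ≤ f) {c : ℝ} (hc : 0 ≤ c) : 0 ≤ c • f := fun x =>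
  mul_nonneg hc (hf x)

lemma functionalPos_smul_le (L : (X →ᵇ ℝ) →L[ℝ] ℝ) {f : X →ᵇ ℝ} (hf : 0 ≤ f) {c : ℝ}
    (hc : 0 < c) : functionalPos L (c • f) ≤ c * functionalPos L f := by
  refine functionalPos_le L (bounded_smul_nonneg hf hc.le) fun g h0 h => ?_
  have e : g = c • (c⁻¹ • g) := by rw [smul_smul, mul_inv_cancel₀ hc.ne', one_smul]
  rw [e, map_smul, smul_eq_mul]
  refine mul_le_mul_of_nonneg_left (le_functionalPos L (bounded_smul_nonneg h0 (by positivity)) ?_) hc.le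
  intro x
  have : g x ≤ c * f x := h x
  change c⁻¹ * g x ≤ f x
  rwa [inv_mul_le_iff₀ hc]

lemma functionalPos_smul (L : (X →ᵇ ℝ) →L[ℝ] ℝ) {f : X →ᵇ ℝ} (hf : 0 ≤ f) {c : ℝ}
    (hc : 0 ≤ c) : functionalPos L (c • f) = c * functionalPos L f := by
  rcases hc.eq_or_lt with rfl | hc
  · simp only [zero_smul, zero_mul]
    refine le_antisymm (functionalPos_le L le_rfl fun g h0 h => ?_) (functionalPos_nonneg L le_rfl)
    rw [le_antisymm h h0, map_zero]
  refine le_antisymm (functionalPos_smul_le L hf hc) ?_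
  have := functionalPos_smul_le L (bounded_smul_nonneg hf hc.le) (inv_pos.2 hc)
  rw [smul_smul, inv_mul_cancel₀ hc.ne', one_smul] at this
  rwa [le_inv_mul_iff₀ hc] at this

/-- A nonnegative function with compact support as a bounded continuous real function. -/
noncomputable def ccToBounded (f : C_c(X, ℝ≥0)) : X →ᵇ ℝ := f.toReal.toBoundedContinuousFunction

lemma ccToBounded_apply (f : C_c(X, ℝ≥0)) (x : X) : ccToBounded f x = f x := by
  simp [ccToBounded]

lemma ccToBounded_nonneg (f : C_c(X, ℝ≥0)) : 0 ≤ ccToBounded f := fun x =>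
  (f x).2.trans_eq (ccToBounded_apply f x).symm

lemma ccToBounded_add (f g : C_c(X, ℝ≥0)) : ccToBounded (f + g) = ccToBounded f + ccToBounded g := by
  ext x; simp [ccToBounded_apply]

lemma ccToBounded_smul (c : ℝ≥0) (f : C_c(X, ℝ≥0)) :
    ccToBounded (c • f) = (c : ℝ) • ccToBounded f := by
  ext x; simp [ccToBounded_apply]

/-- The positive part of a bounded functional as a positive linear functional. -/
noncomputable def posLinear (L : (X →ᵇ ℝ) →L[ℝ] ℝ) : C_c(X, ℝ≥0) →ₗ[ℝ≥0] ℝ≥0 where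
  toFun f := ⟨functionalPos L (ccToBounded f), functionalPos_nonneg L (ccToBounded_nonneg f)⟩
  map_add' f g := by
    apply NNReal.eq
    change functionalPos L (ccToBounded (f + g)) = _ + _
    rw [ccToBounded_add, functionalPos_add L (ccToBounded_nonneg f) (ccToBounded_nonneg g)]
  map_smul' c f := by
    apply NNReal.eq
    change functionalPos L (ccToBounded (c • f)) = c * _
    rw [ccToBounded_smul, functionalPos_smul L (ccToBounded_nonneg f) c.coe_nonneg]

lemma posLinear_apply (L : (X →ᵇ ℝ) →L[ℝ] ℝ) (f : C_c(X, ℝ≥0)) :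
    (posLinear L f : ℝ) = functionalPos L (ccToBounded f) := rfl

/-- The reflection `g ↦ f - g` maps the order interval from `0` to `f` onto itself. This is the
Jordan decomposition of `L`, with the positive part of `-L` as negative part. -/
lemma functionalPos_neg (L : (X →ᵇ ℝ) →L[ℝ] ℝ) {f : X →ᵇ ℝ} (hf : 0 ≤ f) :
    functionalPos (-L) f = functionalPos L f - L f := by
  apply le_antisymm
  · refine functionalPos_le _ hf fun g h0 h => ?_
    have := le_functionalPos L (sub_nonneg.2 h) (sub_le_self f h0)
    rw [map_sub] at this
    change -(L g) ≤ _
    linarith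
  · rw [sub_le_iff_le_add]
    refine functionalPos_le _ hf fun g h0 h => ?_
    have := le_functionalPos (-L) (sub_nonneg.2 h) (sub_le_self f h0)
    change -(L (f - g)) ≤ _ at this
    rw [map_sub] at this
    linarith

variable [T2Space X] [LocallyCompactSpace X] [MeasurableSpace X] [BorelSpace X]

/-- The mass is at most `‖L‖`: by inner regularity it suffices to measure compact sets, and the
indicator of each is dominated by a cutoff with values in `[0, 1]`, on which the positive part is at
most `‖L‖`. -/
lemma isFiniteMeasure_rieszMeasure_posLinear (L : (X →ᵇ ℝ) →L[ℝ] ℝ) :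
    IsFiniteMeasure (NNRealRMK.rieszMeasure (posLinear L)) := by
  refine ⟨lt_of_le_of_lt ?_ (ENNReal.ofReal_lt_top (r := ‖L‖))⟩
  rw [isOpen_univ.measure_eq_iSup_isCompact]
  refine iSup₂_le fun K _ => iSup_le fun hK => ?_
  obtain ⟨f, hf1, -, hfc, hf⟩ :=
    exists_continuous_one_zero_of_isCompact hK isClosed_empty (disjoint_empty K)
  let f' : C_c(X, ℝ≥0) :=
    ⟨⟨fun x => (f x).toNNReal, by fun_prop⟩, hfc.comp_left (g := Real.toNNReal) (by simp)⟩
  calc NNRealRMK.rieszMeasure (posLinear L) K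
      = ∫⁻ x in K, 1 ∂(NNRealRMK.rieszMeasure (posLinear L)) := by simp
    _ ≤ ∫⁻ x in K, f' x ∂(NNRealRMK.rieszMeasure (posLinear L)) := by
        refine setLIntegral_mono' hK.measurableSet fun x hx => ?_
        have : f x = 1 := hf1 hx
        simp [f', this]
    _ ≤ ∫⁻ x, f' x ∂(NNRealRMK.rieszMeasure (posLinear L)) := setLIntegral_le_lintegral _ _
    _ = posLinear L f' := NNRealRMK.lintegral_rieszMeasure _ _
    _ ≤ ENNReal.ofReal ‖L‖ := by
        rw [ENNReal.ofReal, ENNReal.coe_le_coe]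
        refine NNReal.le_toNNReal_of_coe_le ?_
        rw [posLinear_apply]
        refine functionalPos_le L (ccToBounded_nonneg _) fun g h0 h => ?_
        refine (functional_le_of_le L h0 h).trans (mul_le_of_le_one_right L.opNorm_nonneg ?_)
        refine (BoundedContinuousFunction.norm_le zero_le_one).2 fun x => ?_
        rw [ccToBounded_apply]
        simpa [f', (hf x).1, abs_of_nonneg (hf x).1] using (hf x).2

/-- **Riesz representation** for bounded functionals that need not be positive. -/
theorem exists_measure_sub_of_functional (L : (X →ᵇ ℝ) →L[ℝ] ℝ) :
    ∃ μ ν : Measure X, IsFiniteMeasure μ ∧ IsFiniteMeasure ν ∧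
      ∀ f : X →ᵇ ℝ, HasCompactSupport f → L f = ∫ x, f x ∂μ - ∫ x, f x ∂ν := by
  have hμ := isFiniteMeasure_rieszMeasure_posLinear L
  have hν := isFiniteMeasure_rieszMeasure_posLinear (-L)
  refine ⟨_, _, hμ, hν, fun f hf => ?_⟩
  have key : ∀ g : C_c(X, ℝ≥0), L (ccToBounded g) =
      ∫ x, (g x : ℝ) ∂NNRealRMK.rieszMeasure (posLinear L)
        - ∫ x, (g x : ℝ) ∂NNRealRMK.rieszMeasure (posLinear (-L)) := by
    intro g
    rw [NNRealRMK.integral_rieszMeasure, NNRealRMK.integral_rieszMeasure, posLinear_apply,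
      posLinear_apply, functionalPos_neg L (ccToBounded_nonneg g)]
    ring
  let f₁ : C_c(X, ℝ≥0) :=
    ⟨⟨fun x => (f x).toNNReal, by fun_prop⟩, hf.comp_left (g := Real.toNNReal) (by simp)⟩
  let f₂ : C_c(X, ℝ≥0) :=
    ⟨⟨fun x => (-f x).toNNReal, by fun_prop⟩,
      hf.comp_left (g := fun t => Real.toNNReal (-t)) (by simp)⟩
  have hfx : ∀ x, f x = (f₁ x : ℝ) - (f₂ x : ℝ) := by
    intro x
    simp only [f₁, f₂, CompactlySupportedContinuousMap.coe_mk, ContinuousMap.coe_mk,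
      Real.coe_toNNReal']
    rcases max_cases (f x) 0 with h | h <;> rcases max_cases (-f x) 0 with h' | h' <;> linarith
  have e : f = ccToBounded f₁ - ccToBounded f₂ := by
    ext x
    simp only [BoundedContinuousFunction.coe_sub, Pi.sub_apply, ccToBounded_apply]
    exact hfx x
  have int : ∀ (m : Measure X) [IsFiniteMeasure m] (g : C_c(X, ℝ≥0)),
      Integrable (fun x => (g x : ℝ)) m := by
    intro m _ g
    refine Integrable.congr ((ccToBounded g).integrable m) (ae_of_all _ (ccToBounded_apply g))
  rw [integral_congr_ae (ae_of_all _ hfx), integral_congr_ae (ae_of_all _ hfx),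
    integral_sub (int _ _) (int _ _), integral_sub (int _ _) (int _ _)]
  conv_lhs => rw [e, map_sub, key, key]
  ring

end Riesz

end LipTrunc

namespace LipTrunc

variable {n : ℕ}

/-! ### Finite variation and the pairing -/

/-- A vector measure with values in `ℝⁿ` has finite total variation. -/
instance isFiniteMeasure_variation (μ : VectorMeasure (E n) (E n)) :
    IsFiniteMeasure μ.variation := by
  let p : Fin n → SignedMeasure (E n) := fun i =>
    μ.mapRange (EuclideanSpace.proj (𝕜 := ℝ) i).toLinearMap.toAddMonoidHom
      (EuclideanSpace.proj (𝕜 := ℝ) i).continuous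
  -- The coordinates are signed measures, which have finite total variation, and the Euclidean norm
  -- is at most the sum of the absolute coordinates.
  have h : μ.variation ≤ ∑ i, (p i).totalVariation := by
    refine VectorMeasure.variation_le_of_forall_enorm_le fun s hs => ?_
    rw [Measure.finsetSum_apply]
    have h1 : ‖μ s‖ ≤ ∑ i, ‖μ s i‖ := by
      rw [EuclideanSpace.norm_eq]
      refine Real.sqrt_le_iff.2 ⟨Finset.sum_nonneg fun _ _ => norm_nonneg _, ?_⟩
      exact Finset.sum_sq_le_sq_sum_of_nonneg fun _ _ => norm_nonneg _
    calc ‖μ s‖ₑ ≤ ∑ i, ‖μ s i‖ₑ := by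
          simp only [← ofReal_norm]
          rw [← ENNReal.ofReal_sum_of_nonneg fun _ _ => norm_nonneg _]
          exact ENNReal.ofReal_le_ofReal h1
      _ ≤ _ := Finset.sum_le_sum fun i _ => SignedMeasure.enorm_le_totalVariation (p i) s
  exact isFiniteMeasure_of_le _ h

lemma enorm_pairing_le (μ : VectorMeasure (E n) (E n)) (ρ : E n → E n) :
    ‖pairing μ ρ‖ₑ ≤ ∫⁻ x, ‖ρ x‖ₑ ∂μ.variation := by
  refine VectorMeasure.enorm_integral_le_lintegral_enorm.trans ?_
  refine (mul_le_mul_left ?_ _).trans_eq (one_mul _)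
  rw [← ofReal_norm, ENNReal.ofReal_le_one]
  exact norm_innerSL_le ℝ

/-- The pairing with a bounded field supported in `A` is controlled by the variation of `A`. -/
lemma abs_pairing_le {μ : VectorMeasure (E n) (E n)} {ρ : E n → E n} {C : ℝ} {A : Set (E n)}
    (hA : MeasurableSet A) (h : ∀ x, ‖ρ x‖ ≤ C) (hs : ∀ x ∉ A, ρ x = 0) :
    |pairing μ ρ| ≤ C * μ.variation.real A := by
  have hC : 0 ≤ C := (norm_nonneg _).trans (h 0)
  have h1 : ‖pairing μ ρ‖ₑ ≤ ENNReal.ofReal C * μ.variation A := by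
    refine (enorm_pairing_le μ ρ).trans ?_
    rw [← setLIntegral_const, ← lintegral_indicator hA]
    refine lintegral_mono fun x => ?_
    by_cases hx : x ∈ A
    · simp only [indicator_of_mem hx, ← ofReal_norm]
      exact ENNReal.ofReal_le_ofReal (h x)
    · simp [hs x hx]
  have h2 := ENNReal.toReal_mono (by finiteness) h1
  rwa [ENNReal.toReal_mul, ENNReal.toReal_ofReal hC, toReal_enorm, Real.norm_eq_abs] at h2

lemma abs_pairing_le_univ {μ : VectorMeasure (E n) (E n)} {ρ : E n → E n} {C : ℝ}
    (h : ∀ x, ‖ρ x‖ ≤ C) : |pairing μ ρ| ≤ C * μ.variation.real univ :=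
  abs_pairing_le MeasurableSet.univ h (by simp)

lemma pairing_sub {μ : VectorMeasure (E n) (E n)} {ρ σ : E n → E n}
    (hρ : Integrable ρ μ.variation) (hσ : Integrable σ μ.variation) :
    pairing μ (fun x => ρ x - σ x) = pairing μ ρ - pairing μ σ :=
  VectorMeasure.integral_fun_sub hρ hσ

/-- Changes the measure and the set function simultaneously; the domination proof depends on both,
so neither can be rewritten alone. -/
lemma setToFun_congr_of_eq {X F G : Type*} [MeasurableSpace X] [NormedAddCommGroup F]
    [NormedSpace ℝ F] [NormedAddCommGroup G] [NormedSpace ℝ G] {m₁ m₂ : Measure X}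
    {T₁ T₂ : Set X → F →L[ℝ] G} {C : ℝ} (hm : m₁ = m₂) (hT : T₁ = T₂)
    (h₁ : DominatedFinMeasAdditive m₁ T₁ C) (h₂ : DominatedFinMeasAdditive m₂ T₂ C) (f : X → F) :
    setToFun m₁ T₁ h₁ f = setToFun m₂ T₂ h₂ f := by
  subst hm hT
  rfl

/-- The vector measure `ν e` for a finite measure `ν` and a vector `e`. -/
noncomputable def directed (ν : Measure (E n)) [IsFiniteMeasure ν] (e : E n) :
    VectorMeasure (E n) (E n) :=
  ν.toSignedMeasure.mapRange
    (ContinuousLinearMap.toSpanSingleton ℝ e).toLinearMap.toAddMonoidHom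
    (ContinuousLinearMap.toSpanSingleton ℝ e).continuous

lemma directed_apply (ν : Measure (E n)) [IsFiniteMeasure ν] (e : E n) (s : Set (E n)) :
    directed ν e s = ν.toSignedMeasure s • e :=
  VectorMeasure.mapRange_apply _ (f := (ContinuousLinearMap.toSpanSingleton ℝ e).toLinearMap.toAddMonoidHom)
    (ContinuousLinearMap.toSpanSingleton ℝ e).continuous

/-- An integral against a vector measure depends only on its transpose, the operator-valued set
function. For `ν e` with the inner product this agrees with that of the scalar measure `ν` with the
bilinear map `(x, c) ↦ c ⟨e, x⟩`, and the functional `⟨e, ·⟩` can be taken out of the latter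
integral. -/
lemma pairing_directed (ν : Measure (E n)) [IsFiniteMeasure ν] (e : E n) {ρ : E n → E n}
    (hρ : Continuous ρ) {C : ℝ} (hC : ∀ x, ‖ρ x‖ ≤ C) :
    pairing (directed ν e) ρ = ∫ x, inner ℝ (ρ x) e ∂ν := by
  have int : ∀ (m : Measure (E n)) [IsFiniteMeasure m], Integrable ρ m := fun m _ =>
    Integrable.of_bound hρ.aestronglyMeasurable C (ae_of_all _ hC)
  have : Integrable ρ ν.toSignedMeasure.variation := by
    rw [Measure.variation_toSignedMeasure]; exact int ν
  set B : E n →L[ℝ] ℝ →L[ℝ] ℝ := (ContinuousLinearMap.lsmul ℝ ℝ).flip ∘L (innerSL ℝ e) with hB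
  have e1 : pairing (directed ν e) ρ = ∫ᵛ x, ρ x ∂[B; ν.toSignedMeasure] := by
    rw [pairing, VectorMeasure.integral_eq_setToFun_transpose (int _),
      VectorMeasure.integral_eq_setToFun_transpose this]
    have : (directed ν e).transpose (innerSL ℝ) = ν.toSignedMeasure.transpose B := by
      ext s hs x
      rw [transpose_eq_cbmApplyMeasure, transpose_eq_cbmApplyMeasure,
        cbmApplyMeasure_apply, cbmApplyMeasure_apply, directed_apply]
      change inner ℝ x (ν.toSignedMeasure s • e) = ν.toSignedMeasure s * inner ℝ e x
      rw [inner_smul_right, real_inner_comm]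
    exact setToFun_congr_of_eq (by rw [this]) (by rw [this]) _ _ _
  rw [e1, hB, ← VectorMeasure.integral_continuousLinearMap_comp this,
    VectorMeasure.integral_toSignedMeasure]
  simp [real_inner_comm]


/-! ### Existence of the distributional gradient -/

lemma isTestField_smul {g : E n → ℝ} (hg : ContDiff ℝ 1 g) (hc : HasCompactSupport g) (e : E n) :
    ContDiff ℝ 1 (fun x => g x • e) ∧ HasCompactSupport (fun x => g x • e) :=
  ⟨hg.smul contDiff_const, hc.smul_right⟩

lemma sum_mul_coord (L : E n →L[ℝ] ℝ) (e : E n) :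
    ∑ i, L (EuclideanSpace.single i 1) * e i = L e := by
  conv_rhs => rw [← (EuclideanSpace.basisFun (Fin n) ℝ).sum_repr e]
  simp [mul_comm]

/-- The divergence of the field `g e` is the derivative of `g` in direction `e`. -/
lemma divergence_smul_const {g : E n → ℝ} {x : E n} (hg : DifferentiableAt ℝ g x) (e : E n) :
    divergence (fun y => g y • e) x = fderiv ℝ g x e := by
  unfold divergence
  rw [fderiv_smul_const hg e, ← sum_mul_coord (fderiv ℝ g x) e]
  simp

lemma continuous_divergence {ψ : E n → E n} (h : ContDiff ℝ 1 ψ) : Continuous (divergence ψ) := by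
  unfold divergence
  have := h.continuous_fderiv one_ne_zero
  refine continuous_finsetSum _ fun i _ => ?_
  exact (EuclideanSpace.proj (𝕜 := ℝ) i).continuous.comp (by fun_prop)

lemma hasCompactSupport_divergence {ψ : E n → E n} (h : HasCompactSupport ψ) :
    HasCompactSupport (divergence ψ) := by
  refine (h.fderiv (𝕜 := ℝ)).mono fun x hx hx0 => hx ?_
  simp [divergence, hx0]

lemma integrable_mul_continuous_compact {u g : E n → ℝ} (hu : Integrable u) (hg : Continuous g)
    (hc : HasCompactSupport g) : Integrable (fun x => u x * g x) := by
  obtain ⟨C, hC⟩ := hc.exists_bound_of_continuous hg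
  exact hu.mul_bdd hg.aestronglyMeasurable (ae_of_all _ hC)

/-- The bound in the definition of bounded variation, for fields of arbitrary size. -/
lemma IsBV.exists_bound {u : E n → ℝ} (hu : IsBV u) : ∃ M, 0 ≤ M ∧ ∀ (ψ : E n → E n) (C : ℝ),
    ContDiff ℝ 1 ψ → HasCompactSupport ψ → (∀ x, ‖ψ x‖ ≤ C) →
      |∫ x, u x * divergence ψ x| ≤ M * C := by
  obtain ⟨M, hM⟩ := hu.2
  have hM0 : 0 ≤ M := hM ⟨fun _ => 0, contDiff_const, HasCompactSupport.zero, by simp, by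
    simp [divergence]⟩
  have key : ∀ (ψ : E n → E n) (C : ℝ), ContDiff ℝ 1 ψ → HasCompactSupport ψ → 0 < C →
      (∀ x, ‖ψ x‖ ≤ C) → ∫ x, u x * divergence ψ x ≤ M * C := by
    intro ψ C h1 h2 hC h3
    have e : ∀ x, divergence (fun y => C⁻¹ • ψ y) x = C⁻¹ * divergence ψ x := by
      intro x
      unfold divergence
      rw [fderiv_fun_const_smul (h1.differentiable one_ne_zero x), Finset.mul_sum]
      simp
    have := hM ⟨fun y => C⁻¹ • ψ y, h1.const_smul C⁻¹, h2.smul_left (f := fun _ => C⁻¹),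
      fun x => by
        rw [norm_smul, norm_inv, Real.norm_of_nonneg hC.le]
        exact inv_mul_le_one_of_le₀ (h3 x) hC.le, rfl⟩
    simp only [e] at this
    have e2 : ∀ x, u x * (C⁻¹ * divergence ψ x) = C⁻¹ * (u x * divergence ψ x) := fun x => by ring
    simp only [e2, integral_const_mul] at this
    rwa [inv_mul_le_iff₀ hC, mul_comm] at this
  have key0 : ∀ (ψ : E n → E n) (C : ℝ), ContDiff ℝ 1 ψ → HasCompactSupport ψ →
      (∀ x, ‖ψ x‖ ≤ C) → ∫ x, u x * divergence ψ x ≤ M * C := by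
    intro ψ C h1 h2 h3
    have hC : 0 ≤ C := (norm_nonneg _).trans (h3 0)
    refine le_of_forall_pos_le_add fun ε hε => ?_
    -- The bound `C` may be zero, so the normalisation uses a slightly larger positive one; the
    -- excess contributes at most `ε`.
    have := key ψ (C + ε / (M + 1)) h1 h2 (by positivity) fun x => (h3 x).trans (by
      have : 0 ≤ ε / (M + 1) := by positivity
      linarith)
    refine this.trans ?_
    rw [mul_add]
    gcongr
    rw [mul_div_assoc', div_le_iff₀ (by positivity)]
    nlinarith
  refine ⟨M, hM0, fun ψ C h1 h2 h3 => abs_le'.2 ⟨key0 ψ C h1 h2 h3, ?_⟩⟩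
  have := key0 (fun x => -ψ x) C h1.neg (h2.comp_left (g := fun v => -v) neg_zero) (by simpa using h3)
  have e : ∀ x, divergence (fun y => -ψ y) x = -divergence ψ x := by
    intro x
    simp [divergence, fderiv_fun_neg]
  simpa [e, integral_neg] using this

open scoped BoundedContinuousFunction in
/-- The continuously differentiable functions with compact support. -/
def testFunctions (n : ℕ) : Submodule ℝ (E n →ᵇ ℝ) where
  carrier := {f | ContDiff ℝ 1 f ∧ HasCompactSupport f}
  add_mem' hf hg := ⟨hf.1.add hg.1, hf.2.add hg.2⟩
  zero_mem' := ⟨contDiff_const, HasCompactSupport.zero⟩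
  smul_mem' c _ hf := ⟨contDiff_const.smul hf.1, hf.2.smul_left (f := fun _ => c)⟩

open scoped BoundedContinuousFunction in
/-- The distributional derivative in direction `e` as a difference of finite measures. -/
lemma IsBV.exists_measures {u : E n → ℝ} (hu : IsBV u) (e : E n) :
    ∃ μ ν : Measure (E n), IsFiniteMeasure μ ∧ IsFiniteMeasure ν ∧
      ∀ g : E n → ℝ, ContDiff ℝ 1 g → HasCompactSupport g →
        -∫ x, u x * fderiv ℝ g x e = ∫ x, g x ∂μ - ∫ x, g x ∂ν := by
  obtain ⟨M, hM0, hM⟩ := hu.exists_bound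
  have int : ∀ f : testFunctions n, Integrable (fun x => u x * fderiv ℝ (f : E n →ᵇ ℝ) x e) := by
    intro f
    refine integrable_mul_continuous_compact hu.1 ?_ (f.2.2.fderiv_apply ℝ e)
    exact (f.2.1.continuous_fderiv one_ne_zero).clm_apply continuous_const
  let l : testFunctions n →ₗ[ℝ] ℝ :=
    { toFun := fun f => -∫ x, u x * fderiv ℝ (f : E n →ᵇ ℝ) x e
      map_add' := fun f g => by
        have : ∀ x, u x * fderiv ℝ ((f + g : testFunctions n) : E n →ᵇ ℝ) x e =
            u x * fderiv ℝ (f : E n →ᵇ ℝ) x e + u x * fderiv ℝ (g : E n →ᵇ ℝ) x e := by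
          intro x
          have : (((f + g : testFunctions n) : E n →ᵇ ℝ) : E n → ℝ) =
            (f : E n →ᵇ ℝ) + (g : E n →ᵇ ℝ) := rfl
          rw [this, fderiv_add (f.2.1.differentiable one_ne_zero x)
            (g.2.1.differentiable one_ne_zero x)]
          simp [mul_add]
        simp only [this]
        rw [integral_add (int f) (int g), neg_add]
      map_smul' := fun c f => by
        have : ∀ x, u x * fderiv ℝ ((c • f : testFunctions n) : E n →ᵇ ℝ) x e =
            c * (u x * fderiv ℝ (f : E n →ᵇ ℝ) x e) := by
          intro x
          have : (((c • f : testFunctions n) : E n →ᵇ ℝ) : E n → ℝ) =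
            c • ((f : E n →ᵇ ℝ) : E n → ℝ) := rfl
          rw [this, fderiv_const_smul (f.2.1.differentiable one_ne_zero x)]
          simp
          ring
        simp only [this]
        rw [integral_const_mul]
        simp }
  have hl : ∀ f : testFunctions n, ‖l f‖ ≤ (M * ‖e‖) * ‖f‖ := by
    intro f
    obtain ⟨h1, h2⟩ := isTestField_smul f.2.1 f.2.2 e
    have := hM _ (‖(f : E n →ᵇ ℝ)‖ * ‖e‖) h1 h2 fun x => by
      rw [norm_smul]
      gcongr
      exact (f : E n →ᵇ ℝ).norm_coe_le_norm x
    simp only [divergence_smul_const (f.2.1.differentiable one_ne_zero _)] at this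
    change ‖-∫ x, u x * fderiv ℝ (f : E n →ᵇ ℝ) x e‖ ≤ _
    rw [norm_neg, Real.norm_eq_abs]
    refine this.trans_eq ?_
    change M * (‖f‖ * ‖e‖) = _
    ring
  -- The derivative is defined only on `C¹` functions with compact support. Any Hahn–Banach
  -- extension will do, because it is evaluated only on such functions afterwards.
  obtain ⟨L, hL, -⟩ := exists_extension_norm_eq (testFunctions n) (l.mkContinuous _ hl)
  obtain ⟨μ, ν, hμ, hν, h⟩ := exists_measure_sub_of_functional L
  refine ⟨μ, ν, hμ, hν, fun g h1 h2 => ?_⟩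
  obtain ⟨C, hC⟩ := h2.exists_bound_of_continuous h1.continuous
  let f : testFunctions n :=
    ⟨BoundedContinuousFunction.ofNormedAddCommGroup g h1.continuous C hC, h1, h2⟩
  have := h f h2
  rw [hL f] at this
  exact this

lemma integral_mul_divergence {u : E n → ℝ} (hu : Integrable u) {ψ : E n → E n}
    (h1 : ContDiff ℝ 1 ψ) (h2 : HasCompactSupport ψ) :
    ∫ x, u x * divergence ψ x =
      ∑ i, ∫ x, u x * fderiv ℝ (fun y => ψ y i) x (EuclideanSpace.single i 1) := by
  have e : ∀ i x, fderiv ℝ (fun y => ψ y i) x = (EuclideanSpace.proj (𝕜 := ℝ) i) ∘L fderiv ℝ ψ x :=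
    fun i x => ((EuclideanSpace.proj (𝕜 := ℝ) i).hasFDerivAt.comp x
      (h1.differentiable one_ne_zero x).hasFDerivAt).fderiv
  rw [← integral_finsetSum]
  · refine integral_congr_ae (ae_of_all _ fun x => ?_)
    simp only [divergence, Finset.mul_sum, e]
    rfl
  · intro i _
    have hi : ContDiff ℝ 1 fun y => ψ y i := (EuclideanSpace.proj (𝕜 := ℝ) i).contDiff.comp h1
    have hc : HasCompactSupport fun y => ψ y i := h2.comp_left (g := fun v : E n => v i) rfl
    exact integrable_mul_continuous_compact hu
      ((hi.continuous_fderiv one_ne_zero).clm_apply continuous_const) (hc.fderiv_apply ℝ _)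

/-- The gradient is assembled from the coordinate directions as `∑ (μ_i - ν_i) e_i`. -/
theorem IsBV.exists_isDistribGrad {u : E n → ℝ} (hu : IsBV u) :
    ∃ μ : VectorMeasure (E n) (E n), IsDistribGrad u μ := by
  choose μ ν hμ hν h using fun i : Fin n => hu.exists_measures (EuclideanSpace.single i 1)
  refine ⟨∑ i, (directed (μ i) (EuclideanSpace.single i 1)
    - directed (ν i) (EuclideanSpace.single i 1)), fun ψ h1 h2 => ?_⟩
  obtain ⟨C, hC⟩ := h2.exists_bound_of_continuous h1.continuous
  have int : ∀ m : VectorMeasure (E n) (E n), Integrable ψ m.variation := fun m =>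
    Integrable.of_bound h1.continuous.aestronglyMeasurable C (ae_of_all _ hC)
  rw [pairing, VectorMeasure.integral_finsetSum_vectorMeasure fun i _ => int _,
    integral_mul_divergence hu.1 h1 h2, ← Finset.sum_neg_distrib]
  refine Finset.sum_congr rfl fun i _ => ?_
  rw [VectorMeasure.integral_sub_vectorMeasure (int _) (int _)]
  have hi : ContDiff ℝ 1 fun y => ψ y i := (EuclideanSpace.proj (𝕜 := ℝ) i).contDiff.comp h1
  have hc : HasCompactSupport fun y => ψ y i := h2.comp_left (g := fun v : E n => v i) rfl
  rw [h i _ hi hc]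
  have := pairing_directed (μ i) (EuclideanSpace.single i 1) h1.continuous hC
  have := pairing_directed (ν i) (EuclideanSpace.single i 1) h1.continuous hC
  simp only [pairing] at *
  simp [*, EuclideanSpace.inner_single_right]

/-- `D u` is the distributional gradient of a function of bounded variation. -/
theorem IsBV.isDistribGrad {u : E n → ℝ} (hu : IsBV u) : IsDistribGrad u (D u) := by
  rw [D, dif_pos hu.exists_isDistribGrad]
  exact hu.exists_isDistribGrad.choose_spec

end LipTrunc

namespace LipTrunc

variable {n : ℕ}

/-! ### Translations -/

lemma continuous_comp_sub {F : Type*} [TopologicalSpace F] {ψ : E n → F} (hψ : Continuous ψ)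
    (y : E n) : Continuous fun x => ψ (x - y) := hψ.comp (continuous_id.sub continuous_const)

/-- A first order Taylor estimate, integrated against an integrable family of functionals. -/
lemma abs_integral_translate_sub_le {F : Type*} [NormedAddCommGroup F] [NormedSpace ℝ F]
    {B : E n → F →L[ℝ] ℝ} (hB : Integrable B) {ψ : E n → F} (hψ : ContDiff ℝ 1 ψ)
    (hc : HasCompactSupport ψ) (y : E n) {M : ℝ}
    (hM : ∀ s ∈ Icc (0 : ℝ) 1, |∫ x, B x (fderiv ℝ ψ (x - s • y) y)| ≤ M) :
    |(∫ x, B x (ψ (x - y))) - ∫ x, B x (ψ x)| ≤ M := by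
  have hdψ := hψ.continuous_fderiv one_ne_zero
  obtain ⟨C₀, hC₀⟩ := hc.exists_bound_of_continuous hψ.continuous
  obtain ⟨C₁, hC₁⟩ := (hc.fderiv (𝕜 := ℝ)).exists_bound_of_continuous hdψ
  have int : ∀ {g : E n → F}, Continuous g → AEStronglyMeasurable (fun x => B x (g x)) volume := by
    intro g hg
    exact (ContinuousLinearMap.id ℝ (F →L[ℝ] ℝ)).aestronglyMeasurable_comp₂
      hB.aestronglyMeasurable hg.aestronglyMeasurable
  -- Differentiate under the integral along the segment of shifts `s y`; the mean value inequality
  -- on `[0, 1]` then concludes.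
  have hd : ∀ s : ℝ, HasDerivAt (fun s : ℝ => ∫ x, B x (ψ (x - s • y)))
      (∫ x, B x (-(fderiv ℝ ψ (x - s • y) y))) s := by
    intro s
    refine (hasDerivAt_integral_of_dominated_loc_of_deriv_le (s := univ) univ_mem
      (F := fun s x => B x (ψ (x - s • y)))
      (F' := fun s x => B x (-(fderiv ℝ ψ (x - s • y) y)))
      (bound := fun x => ‖B x‖ * (C₁ * ‖y‖))
      (Eventually.of_forall fun t => int (continuous_comp_sub hψ.continuous _)) ?_ ?_ ?_ ?_ ?_).2
    · refine (hB.norm.mul_const C₀).mono (int (continuous_comp_sub hψ.continuous _))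
        (ae_of_all _ fun x => ?_)
      refine ((B x).le_opNorm _).trans ?_
      rw [Real.norm_of_nonneg (mul_nonneg (norm_nonneg _) ((norm_nonneg _).trans (hC₀ 0)))]
      gcongr
      exact hC₀ _
    · exact int ((continuous_comp_sub hdψ _).clm_apply continuous_const).neg
    · refine ae_of_all _ fun x t _ => ((B x).le_opNorm _).trans ?_
      rw [norm_neg]
      gcongr
      refine (ContinuousLinearMap.le_opNorm _ _).trans ?_
      gcongr
      exact hC₁ _
    · exact hB.norm.mul_const _
    · refine ae_of_all _ fun x t _ => (B x).hasFDerivAt.comp_hasDerivAt t ?_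
      have h1 : HasDerivAt (fun t : ℝ => x - t • y) (-y) t := by
        simpa using ((hasDerivAt_id t).smul_const y).const_sub x
      have h2 := ((hψ.differentiable one_ne_zero _).hasFDerivAt).comp_hasDerivAt t h1
      rw [map_neg] at h2
      exact h2
  have := norm_image_sub_le_of_norm_deriv_le_segment_01' (C := M)
    (fun s _ => (hd s).hasDerivWithinAt) (fun s hs => by
      simp only [map_neg, integral_neg, norm_neg]
      exact hM s ⟨hs.1, hs.2.le⟩)
  simpa using this

lemma norm_convolution_le_of_bound {F : Type*} [NormedAddCommGroup F] [NormedSpace ℝ F]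
    {κ : E n → ℝ} (h0 : ∀ x, 0 ≤ κ x) (h1 : ∫ x, κ x = 1) {g : E n → F} {C : ℝ}
    (hg : ∀ᵐ x, ‖g x‖ ≤ C) (x : E n) :
    ‖(κ ⋆[ContinuousLinearMap.lsmul ℝ ℝ, volume] g) x‖ ≤ C := by
  -- The integral of a non-integrable function is `0` by convention, so mass one forces
  -- integrability.
  have hint : Integrable κ := by
    by_contra h
    simp [integral_undef h] at h1
  have hg' : ∀ᵐ t, ‖g (x - t)‖ ≤ C :=
    (quasiMeasurePreserving_sub_left_of_right_invariant volume x).ae hg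
  calc ‖(κ ⋆[ContinuousLinearMap.lsmul ℝ ℝ, volume] g) x‖
      ≤ ∫ t, κ t * C := by
        refine norm_integral_le_of_norm_le (hint.mul_const C) ?_
        filter_upwards [hg'] with t ht
        simp only [ContinuousLinearMap.lsmul_apply, norm_smul, Real.norm_of_nonneg (h0 t)]
        exact mul_le_mul_of_nonneg_left ht (h0 t)
    _ = C := by rw [integral_mul_const, h1, one_mul]

/-- Dual description of the `L¹` norm on a bounded set. -/
lemma setIntegral_abs_le_of_forall_smooth {g : E n → ℝ} (hg : Integrable g) {A : Set (E n)}
    (hA : MeasurableSet A) (hb : Bornology.IsBounded A) {δ C : ℝ} (hδ : 0 < δ)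
    (h : ∀ ψ : E n → ℝ, ContDiff ℝ 1 ψ → HasCompactSupport ψ → (∀ x, |ψ x| ≤ 1) →
      (∀ x ∉ Metric.thickening δ A, ψ x = 0) → ∫ x, g x * ψ x ≤ C) :
    ∫ x in A, |g x| ≤ C := by
  -- The sign of `g` on `A`, equal to `0` where `g = 0` since division by zero gives zero. It
  -- attains the `L¹` norm but must be smoothed to become a test function.
  set σ : E n → ℝ := A.indicator fun x => g x / |g x| with hσ
  have hσ1 : ∀ x, ‖σ x‖ ≤ 1 := by
    intro x
    by_cases hx : x ∈ A
    · simp only [hσ, indicator_of_mem hx, norm_div, Real.norm_eq_abs, abs_abs]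
      exact div_self_le_one _
    · simp [hσ, hx]
  have hσm : AEStronglyMeasurable σ volume := by
    refine AEStronglyMeasurable.indicator ?_ hA
    exact (hg.aemeasurable.div hg.aemeasurable.norm).aestronglyMeasurable
  have hσloc : LocallyIntegrable σ volume := by
    refine (locallyIntegrable_const (1 : ℝ)).mono hσm (ae_of_all _ fun x => ?_)
    simpa using hσ1 x
  have hσc : HasCompactSupport σ := by
    refine HasCompactSupport.intro (K := closure A) hb.isCompact_closure fun x hx => ?_
    exact indicator_of_notMem (fun h => hx (subset_closure h)) _
  -- The outer radii tend to zero and stay below `δ`, so the supports remain in the thickening. The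
  -- fixed ratio `2` of outer to inner radius is what almost everywhere convergence of the
  -- convolutions requires.
  let b : ℕ → ContDiffBump (0 : E n) := fun k =>
    ⟨δ / (k + 2) / 2, δ / (k + 2), by positivity, half_lt_self (by positivity)⟩
  have hb0 : Tendsto (fun k => (b k).rOut) atTop (𝓝 0) := by
    have : Tendsto (fun k : ℕ => (k : ℝ) + 2) atTop atTop :=
      tendsto_atTop_add_const_right _ _ tendsto_natCast_atTop_atTop
    exact tendsto_const_nhds.div_atTop this
  have hbδ : ∀ k, (b k).rOut < δ := fun k => by
    change δ / (k + 2) < δ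
    rw [div_lt_iff₀ (by positivity)]
    have : (0 : ℝ) ≤ k := k.cast_nonneg
    nlinarith
  have hlim := ContDiffBump.ae_convolution_tendsto_right_of_locallyIntegrable (K := 2) hb0
    (Eventually.of_forall fun k => by
      change δ / (k + 2) ≤ 2 * (δ / (k + 2) / 2)
      linarith) hσloc
  set Ψ : ℕ → E n → ℝ := fun k =>
    ((b k).normed volume ⋆[ContinuousLinearMap.lsmul ℝ ℝ, volume] σ) with hΨ
  have hΨ1 : ∀ k x, ‖Ψ k x‖ ≤ 1 := fun k x =>
    norm_convolution_le_of_bound (fun x => (b k).nonneg_normed x) ((b k).integral_normed)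
      (ae_of_all _ hσ1) x
  have hΨd : ∀ k, ContDiff ℝ 1 (Ψ k) := fun k =>
    HasCompactSupport.contDiff_convolution_left (n := 1) _ (b k).hasCompactSupport_normed
      (b k).contDiff_normed hσloc
  have hΨs : ∀ k, ∀ x ∉ Metric.thickening δ A, Ψ k x = 0 := by
    intro k x hx
    by_contra hne
    have := support_convolution_subset (ContinuousLinearMap.lsmul ℝ ℝ) (μ := volume) hne
    obtain ⟨y, hy, z, hz, rfl⟩ := this
    have hz' : z ∈ A := by
      by_contra hz'
      exact hz (indicator_of_notMem hz' _)
    rw [(b k).support_normed_eq] at hy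
    refine hx (Metric.mem_thickening_iff.2 ⟨z, hz', ?_⟩)
    rw [dist_eq_norm, add_sub_cancel_right]
    exact (mem_ball_zero_iff.1 hy).trans (hbδ k)
  have hL : Tendsto (fun k => ∫ x, g x * Ψ k x) atTop (𝓝 (∫ x, g x * σ x)) := by
    refine tendsto_integral_of_dominated_convergence (fun x => ‖g x‖)
      (fun k => hg.aestronglyMeasurable.mul (hΨd k).continuous.aestronglyMeasurable) hg.norm
      (fun k => ae_of_all _ fun x => ?_) ?_
    · rw [norm_mul]
      exact mul_le_of_le_one_right (norm_nonneg _) (hΨ1 k x)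
    · filter_upwards [hlim] with x hx
      exact hx.const_mul _
  have hE : ∫ x, g x * σ x = ∫ x in A, |g x| := by
    rw [← integral_indicator hA]
    refine integral_congr_ae (ae_of_all _ fun x => ?_)
    by_cases hx : x ∈ A
    · simp only [hσ, indicator_of_mem hx]
      rcases eq_or_ne (g x) 0 with h | h
      · simp [h]
      · rw [mul_div_assoc', ← abs_mul_abs_self (g x), mul_div_assoc, div_self (abs_ne_zero.2 h),
          mul_one]
    · simp [hσ, hx]
  rw [← hE]
  refine le_of_tendsto hL (Eventually.of_forall fun k => h _ (hΨd k) ?_ (hΨ1 k) (hΨs k))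
  exact HasCompactSupport.convolution _ (b k).hasCompactSupport_normed hσc

lemma pairing_smul_const_eq {u g : E n → ℝ} {μ : VectorMeasure (E n) (E n)}
    (hu : IsDistribGrad u μ) (hg : ContDiff ℝ 1 g) (hc : HasCompactSupport g) (e : E n) :
    ∫ x, u x * fderiv ℝ g x e = -pairing μ fun x => g x • e := by
  obtain ⟨h1, h2⟩ := isTestField_smul hg hc e
  rw [hu _ h1 h2, neg_neg]
  exact integral_congr_ae (ae_of_all _ fun x => by
    simp only [divergence_smul_const (hg.differentiable one_ne_zero x)])

/-- The increments of a function of bounded variation are controlled by its variation. -/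
lemma setIntegral_abs_translate_sub_le {u : E n → ℝ} (hu : Integrable u)
    {μ : VectorMeasure (E n) (E n)} (hμ : IsDistribGrad u μ) {A V : Set (E n)}
    (hA : MeasurableSet A) (hb : Bornology.IsBounded A) (hV : MeasurableSet V) {δ : ℝ} (hδ : 0 < δ)
    (h : E n) (hh : ∀ x ∈ Metric.thickening δ A, ∀ s ∈ Icc (0 : ℝ) 1, x + s • h ∈ V) :
    ∫ x in A, |u (x + h) - u x| ≤ ‖h‖ * μ.variation.real V := by
  have huh : Integrable fun x => u (x + h) := hu.comp_add_right h
  refine setIntegral_abs_le_of_forall_smooth (huh.sub hu) hA hb hδ fun ψ h1 h2 h3 h4 => ?_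
  have hi : ∀ y, Integrable fun x => u x * ψ (x - y) := fun y =>
    hu.mul_bdd (continuous_comp_sub h1.continuous y).aestronglyMeasurable
      (ae_of_all _ fun x => (h3 _ : ‖ψ (x - y)‖ ≤ 1))
  -- The increment is moved from `u` to the smooth function `ψ`.
  have e1 : ∫ x, (u (x + h) - u x) * ψ x = (∫ x, u x * ψ (x - h)) - ∫ x, u x * ψ x := by
    have : ∫ x, u (x + h) * ψ x = ∫ x, u x * ψ (x - h) := by
      rw [← integral_add_right_eq_self (fun x => u x * ψ (x - h)) h]
      simp
    rw [← this, ← integral_sub]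
    · simp only [sub_mul]
    · have := (hi h).comp_add_right h
      simpa using this
    · simpa using hi 0
  change ∫ x, (u (x + h) - u x) * ψ x ≤ _
  rw [e1]
  have hB : Integrable fun x => u x • ContinuousLinearMap.id ℝ ℝ := hu.smul_const _
  have key := abs_integral_translate_sub_le hB h1 h2 h (M := ‖h‖ * μ.variation.real V) ?_
  · exact (le_abs_self _).trans (by simpa using key)
  intro s hs
  -- The derivative of `ψ(· - s h)` along `h` is the divergence of the field `ψ(· - s h) h`, which
  -- is at most `‖h‖` in norm and vanishes off `V`; its integral against `u` is thus controlled by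
  -- `|μ|(V)`.
  have hg : ContDiff ℝ 1 fun x => ψ (x - s • h) := h1.comp (contDiff_id.sub contDiff_const)
  have hgc : HasCompactSupport fun x => ψ (x - s • h) :=
    h2.comp_homeomorph (Homeomorph.subRight (s • h))
  have e2 : ∀ x, fderiv ℝ ψ (x - s • h) h = fderiv ℝ (fun x => ψ (x - s • h)) x h := by
    intro x
    rw [fderiv_comp_sub]
  simp only [e2, smul_apply, ContinuousLinearMap.id_apply, smul_eq_mul]
  rw [pairing_smul_const_eq hμ hg hgc, abs_neg]
  refine abs_pairing_le hV (fun x => ?_) fun x hx => ?_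
  · rw [norm_smul]
    exact mul_le_of_le_one_left (norm_nonneg _) (h3 _)
  · rw [h4, zero_smul]
    intro hx'
    exact hx (by simpa using hh _ hx' s hs)

end LipTrunc

namespace LipTrunc

variable {n : ℕ}

/-! ### Cubes -/

lemma cube_eq_preimage (a : E n) (s : ℝ) :
    cube a s = (WithLp.ofLp : E n → (Fin n → ℝ)) ⁻¹'
      (univ.pi fun i => Ioo (a i - s / 2) (a i + s / 2)) := by
  ext x
  simp only [cube, mem_ofPred_eq, mem_preimage, mem_univ_pi, mem_Ioo, abs_lt]
  exact forall_congr' fun i => ⟨fun h => ⟨by linarith [h.1], by linarith [h.2]⟩,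
    fun h => ⟨by linarith [h.1], by linarith [h.2]⟩⟩

lemma isOpen_cube (a : E n) (s : ℝ) : IsOpen (cube a s) := by
  rw [cube_eq_preimage]
  exact (isOpen_set_pi finite_univ fun i _ => isOpen_Ioo).preimage (PiLp.continuous_ofLp 2 _)

lemma measurableSet_cube (a : E n) (s : ℝ) : MeasurableSet (cube a s) :=
  (isOpen_cube a s).measurableSet

lemma volume_cube (a : E n) {s : ℝ} (hs : 0 ≤ s) : volume (cube a s) = ENNReal.ofReal (s ^ n) := by
  rw [cube_eq_preimage, (PiLp.volume_preserving_ofLp (Fin n)).measure_preimage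
    (MeasurableSet.univ_pi fun i => measurableSet_Ioo).nullMeasurableSet, Real.volume_pi_Ioo]
  simp only [add_sub_sub_cancel, add_halves, Finset.prod_const, Finset.card_univ, Fintype.card_fin]
  rw [ENNReal.ofReal_pow hs]

lemma cube_mono (a : E n) {s t : ℝ} (h : s ≤ t) : cube a s ⊆ cube a t := fun x hx i =>
  (hx i).trans_le (by linarith)

lemma abs_coord_le_norm (x : E n) (i : Fin n) : |x i| ≤ ‖x‖ := PiLp.norm_apply_le x i

lemma norm_le_sum_abs (x : E n) : ‖x‖ ≤ ∑ i, |x i| := by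
  rw [EuclideanSpace.norm_eq]
  refine Real.sqrt_le_iff.2 ⟨Finset.sum_nonneg fun _ _ => abs_nonneg _, ?_⟩
  exact Finset.sum_sq_le_sq_sum_of_nonneg fun _ _ => abs_nonneg _

lemma norm_sub_le_of_mem_cube {a x : E n} {s : ℝ} (hx : x ∈ cube a s) : ‖x - a‖ ≤ n * (s / 2) := by
  refine (norm_le_sum_abs _).trans ((Finset.sum_le_sum fun i _ => (hx i).le).trans_eq ?_)
  simp

lemma isBounded_cube (a : E n) (s : ℝ) : Bornology.IsBounded (cube a s) :=
  (Metric.isBounded_closedBall (x := a) (r := n * (s / 2))).subset fun x hx => by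
    rw [mem_closedBall_iff_norm]
    exact norm_sub_le_of_mem_cube hx

/-- A point close to a point of a cube lies in a larger cube. -/
lemma mem_cube_of_near {a x y : E n} {s d t : ℝ} (hx : x ∈ cube a s) (hd : ∀ i, |y i - x i| ≤ d)
    (ht : s / 2 + d ≤ t / 2) : y ∈ cube a t := fun i => by
  have : y i - a i = (y i - x i) + (x i - a i) := by ring
  rw [this]
  have h1 := hx i
  have h2 := hd i
  exact (abs_add_le _ _).trans_lt (by linarith)

lemma closure_cube_subset (a : E n) {s t : ℝ} (h : s < t) : closure (cube a s) ⊆ cube a t := by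
  intro x hx
  obtain ⟨y, hy, hd⟩ := Metric.mem_closure_iff.1 hx ((t - s) / 2) (by linarith)
  refine mem_cube_of_near (d := (t - s) / 2) hy (fun i => ?_) (by linarith)
  have := abs_coord_le_norm (x - y) i
  rw [dist_eq_norm] at hd
  exact this.trans hd.le

/-! ### A Poincaré inequality -/

lemma aemeasurable_increment {u : E n → ℝ} (hu : Integrable u) :
    AEMeasurable (fun p : E n × E n => ‖u (p.1 + p.2) - u p.1‖ₑ) (volume.prod volume) := by
  have h1 : AEStronglyMeasurable (fun p : E n × E n => u p.1) (volume.prod volume) :=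
    hu.aestronglyMeasurable.comp_quasiMeasurePreserving Measure.quasiMeasurePreserving_fst
  have h2 : AEStronglyMeasurable (fun p : E n × E n => u (p.1 + p.2)) (volume.prod volume) :=
    hu.aestronglyMeasurable.comp_quasiMeasurePreserving
      (Measure.quasiMeasurePreserving_snd.comp
        (measurePreserving_prod_add (volume : Measure (E n)) volume).quasiMeasurePreserving)
  exact (h2.sub h1).enorm

/-- Substitute `y = x + h`, where `h` ranges over a cube of twice the side, exchange the integrals,
and apply the translation estimate for each `h`, whose norm is at most `n r`. -/
lemma lintegral_increments_cube_le {u : E n → ℝ} (hu : Integrable u)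
    {μ : VectorMeasure (E n) (E n)} (hμ : IsDistribGrad u μ) (a : E n) {r : ℝ} (hr : 0 < r) :
    ∫⁻ x in cube a r, ∫⁻ y in cube a r, ‖u y - u x‖ₑ ≤
      ENNReal.ofReal ((2 * r) ^ n * (n * r * μ.variation.real (cube a (4 * r)))) := by
  have hQ := measurableSet_cube a r
  have hP := measurableSet_cube (0 : E n) (2 * r)
  have step : ∀ x ∈ cube a r, ∫⁻ y in cube a r, ‖u y - u x‖ₑ ≤
      ∫⁻ h in cube (0 : E n) (2 * r), ‖u (x + h) - u x‖ₑ := by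
    intro x hx
    rw [← lintegral_indicator hQ, ← lintegral_indicator hP,
      ← lintegral_add_left_eq_self _ x]
    refine lintegral_mono fun h => ?_
    by_cases hh : x + h ∈ cube a r
    · have : h ∈ cube (0 : E n) (2 * r) := by
        intro i
        have h1 := abs_lt.1 (hh i)
        have h2 := abs_lt.1 (hx i)
        simp only [PiLp.add_apply, PiLp.zero_apply, sub_zero] at h1 ⊢
        exact abs_lt.2 ⟨by linarith [h1.1, h2.2], by linarith [h1.2, h2.1]⟩
      rw [indicator_of_mem hh, indicator_of_mem this]
    · simp [hh]
  have trans_le : ∀ h ∈ cube (0 : E n) (2 * r), ∫⁻ x in cube a r, ‖u (x + h) - u x‖ₑ ≤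
      ENNReal.ofReal (n * r * μ.variation.real (cube a (4 * r))) := by
    intro h hh
    have hn : ‖h‖ ≤ n * r := by
      have := norm_sub_le_of_mem_cube hh
      rw [sub_zero] at this
      linarith
    have hc : ∀ i, |h i| ≤ r := fun i => by
      have := hh i
      simp only [PiLp.zero_apply, sub_zero] at this
      linarith
    -- Coordinatewise, the half side `r/2`, the thickening `r/2` and the shift `r` add up to `2r`,
    -- the half side of the cube of side `4r`.
    have key := setIntegral_abs_translate_sub_le hu hμ hQ (isBounded_cube a r)
      (measurableSet_cube a (4 * r)) (δ := r / 2) (by positivity) h fun x hx s hs => by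
        obtain ⟨z, hz, hxz⟩ := Metric.mem_thickening_iff.1 hx
        refine mem_cube_of_near (d := 3 / 2 * r) hz (fun i => ?_) (by linarith)
        have h1 : |(x - z) i| ≤ r / 2 :=
          (abs_coord_le_norm _ i).trans (by rw [← dist_eq_norm]; exact hxz.le)
        have h2 : |s * h i| ≤ r := by
          rw [abs_mul, abs_of_nonneg hs.1]
          exact (mul_le_of_le_one_left (abs_nonneg _) hs.2).trans (hc i)
        have e : (x + s • h) i - z i = (x - z) i + s * h i := by
          simp only [PiLp.add_apply, PiLp.smul_apply, PiLp.sub_apply, smul_eq_mul]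
          ring
        rw [e]
        exact (abs_add_le _ _).trans (by linarith)
    have hint : Integrable fun x => u (x + h) - u x := (hu.comp_add_right h).sub hu
    rw [← ofReal_integral_norm_eq_lintegral_enorm hint.integrableOn]
    refine ENNReal.ofReal_le_ofReal (key.trans ?_)
    gcongr
  calc ∫⁻ x in cube a r, ∫⁻ y in cube a r, ‖u y - u x‖ₑ
      ≤ ∫⁻ x in cube a r, ∫⁻ h in cube (0 : E n) (2 * r), ‖u (x + h) - u x‖ₑ :=
        setLIntegral_mono' hQ step
    _ = ∫⁻ h in cube (0 : E n) (2 * r), ∫⁻ x in cube a r, ‖u (x + h) - u x‖ₑ := by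
        refine lintegral_lintegral_swap ?_
        rw [Measure.prod_restrict]
        exact (aemeasurable_increment hu).restrict
    _ ≤ ∫⁻ _ in cube (0 : E n) (2 * r),
          ENNReal.ofReal (n * r * μ.variation.real (cube a (4 * r))) :=
        setLIntegral_mono' hP trans_le
    _ = _ := by
        rw [setLIntegral_const, volume_cube _ (by positivity), mul_comm,
          ← ENNReal.ofReal_mul (by positivity)]

/-- **Poincaré inequality** on a cube, with the mean over a subset of proportional measure. -/
theorem setIntegral_abs_sub_average_le {u : E n → ℝ} (hu : Integrable u)
    {μ : VectorMeasure (E n) (E n)} (hμ : IsDistribGrad u μ) (a : E n) {r κ : ℝ} (hr : 0 < r)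
    (hκ : 0 < κ) {A : Set (E n)} (hAQ : A ⊆ cube a r)
    (hvol : κ * r ^ n ≤ volume.real A) :
    ∫ x in cube a r, |u x - ⨍ y in A, u y| ≤
      κ⁻¹ * 2 ^ n * n * r * μ.variation.real (cube a (4 * r)) := by
  have hQ := measurableSet_cube a r
  have hAfin : volume A ≠ ⊤ :=
    ((measure_mono hAQ).trans_lt (by rw [volume_cube a hr.le]; exact ENNReal.ofReal_lt_top)).ne
  have hApos : 0 < volume.real A := lt_of_lt_of_le (by positivity) hvol
  have hQfin : volume (cube a r) ≠ ⊤ := by rw [volume_cube a hr.le]; exact ENNReal.ofReal_ne_top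
  -- Averaging `u x - u y` over `y ∈ A` and enlarging the domain from `A` to the cube reduces
  -- everything to double increments; the ratio of the two volumes is paid for by `κ⁻¹`.
  have h1 : ∀ x, ‖u x - ⨍ y in A, u y‖ₑ ≤
      ENNReal.ofReal (volume.real A)⁻¹ * ∫⁻ y in cube a r, ‖u y - u x‖ₑ := by
    intro x
    have hi : IntegrableOn (fun y => u y - u x) A :=
      hu.integrableOn.sub (integrableOn_const hAfin)
    have e : (⨍ y in A, u y) - u x = (volume.real A)⁻¹ * ∫ y in A, (u y - u x) := by
      rw [setAverage_eq, integral_sub hu.integrableOn (integrableOn_const hAfin), setIntegral_const]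
      simp only [smul_eq_mul]
      field_simp
    rw [← enorm_neg, neg_sub, e, enorm_mul, ← ofReal_norm (volume.real A)⁻¹,
      Real.norm_of_nonneg (by positivity)]
    gcongr
    exact (enorm_integral_le_lintegral_enorm _).trans (lintegral_mono_set hAQ)
  have h2 : ∫⁻ x in cube a r, ‖u x - ⨍ y in A, u y‖ₑ ≤ ENNReal.ofReal ((volume.real A)⁻¹ *
      ((2 * r) ^ n * (n * r * μ.variation.real (cube a (4 * r))))) := by
    rw [ENNReal.ofReal_mul (by positivity)]
    refine (lintegral_mono h1).trans ?_
    rw [lintegral_const_mul' _ _ ENNReal.ofReal_ne_top]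
    gcongr
    exact lintegral_increments_cube_le hu hμ a hr
  have hi : IntegrableOn (fun x => u x - ⨍ y in A, u y) (cube a r) :=
    hu.integrableOn.sub (integrableOn_const hQfin)
  rw [← ofReal_integral_norm_eq_lintegral_enorm hi] at h2
  have h3 := (ENNReal.ofReal_le_ofReal_iff (by positivity)).1 h2
  refine h3.trans ?_
  have h4 : (volume.real A)⁻¹ * (2 * r) ^ n ≤ κ⁻¹ * 2 ^ n := by
    rw [inv_mul_le_iff₀ hApos, mul_pow]
    have : 2 ^ n * r ^ n = (κ * r ^ n) * (κ⁻¹ * 2 ^ n) := by field_simp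
    rw [this]
    gcongr
  calc _ = ((volume.real A)⁻¹ * (2 * r) ^ n) * (n * r * μ.variation.real (cube a (4 * r))) := by ring
    _ ≤ (κ⁻¹ * 2 ^ n) * (n * r * μ.variation.real (cube a (4 * r))) := by gcongr
    _ = _ := by ring

end LipTrunc

namespace LipTrunc

variable {n : ℕ}

/-! ### Exterior balls of Lipschitz domains -/

/-- Near a boundary point, the complement of a Lipschitz domain contains balls of comparable size
at every scale. -/
lemma exists_exterior_ball_of_graph {Ω : Set (E n)} {x ν : E n} {R : ℝ} {L : NNReal} {γ : E n → ℝ}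
    (hν : ‖ν‖ = 1) (hγ : LipschitzWith L γ)
    (hΩ : ∀ y ∈ Metric.ball x R, y ∈ Ω ↔ γ (y - (inner ℝ ν y) • ν) < inner ℝ ν y)
    {z : E n} (hz : z ∈ Metric.ball x (R / 2)) (hzΩ : z ∉ Ω) {s : ℝ} (hs : 0 < s)
    (hsR : s ≤ R / 2) :
    ∃ y, Metric.ball y ((4 * (1 + (L : ℝ)))⁻¹ * s) ⊆ Metric.ball z s ∩ Ωᶜ := by
  have hL : (0 : ℝ) ≤ L := L.2
  set κ : ℝ := (4 * (1 + (L : ℝ)))⁻¹ with hκ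
  have hκ0 : 0 < κ := by positivity
  have hκ1 : 4 * κ + 4 * κ * L = 1 := by
    rw [hκ]; field_simp
  have hκL : 0 ≤ κ * L := by positivity
  have hνν : inner ℝ ν ν = (1 : ℝ) := by rw [real_inner_self_eq_norm_sq, hν]; norm_num
  -- Starting on or below the graph, go down by `s/2`. Within radius `κ s` the height changes by at
  -- most `κ s` and the graph by at most `2 L κ s`, and `κ + 2 κ L < 1/2`.
  refine ⟨z - (s / 2) • ν, fun w hw => ?_⟩
  rw [mem_ball_iff_norm] at hw
  set d : E n := w - (z - (s / 2) • ν) with hd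
  have hw' : w = z - (s / 2) • ν + d := by rw [hd]; abel
  have hwz : w ∈ Metric.ball z s := by
    rw [mem_ball_iff_norm]
    have : w - z = d - (s / 2) • ν := by rw [hd]; abel
    rw [this]
    refine (norm_sub_le _ _).trans_lt ?_
    rw [norm_smul, hν, mul_one, Real.norm_of_nonneg (by positivity)]
    nlinarith
  refine ⟨hwz, fun hwΩ => ?_⟩
  have hzx := mem_ball_iff_norm.1 hz
  have hwz' := mem_ball_iff_norm.1 hwz
  have hwx : w ∈ Metric.ball x R := by
    rw [mem_ball_iff_norm]
    have : w - x = (w - z) + (z - x) := by abel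
    rw [this]
    exact (norm_add_le _ _).trans_lt (by linarith)
  have hzx' : z ∈ Metric.ball x R := by
    rw [mem_ball_iff_norm]
    linarith [norm_nonneg (z - x)]
  have h1 := (hΩ w hwx).1 hwΩ
  have h2 : inner ℝ ν z ≤ γ (z - (inner ℝ ν z) • ν) := not_lt.1 fun h => hzΩ ((hΩ z hzx').2 h)
  have hin : inner ℝ ν w = inner ℝ ν z - s / 2 + inner ℝ ν d := by
    rw [hw', inner_add_right, inner_sub_right, inner_smul_right, hνν]
    ring
  have hdn : |inner ℝ ν d| ≤ ‖d‖ := by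
    have := abs_real_inner_le_norm ν d
    rwa [hν, one_mul] at this
  have hproj : ‖(z - (inner ℝ ν z) • ν) - (w - (inner ℝ ν w) • ν)‖ ≤ 2 * ‖d‖ := by
    have : (z - (inner ℝ ν z) • ν) - (w - (inner ℝ ν w) • ν) = (inner ℝ ν d) • ν - d := by
      rw [hin, hd]
      module
    rw [this]
    refine (norm_sub_le _ _).trans ?_
    rw [norm_smul, hν, mul_one, Real.norm_eq_abs]
    linarith
  have h3 := (le_abs_self _).trans ((Real.dist_eq _ _).symm.le.trans
    (hγ.dist_le_mul (z - (inner ℝ ν z) • ν) (w - (inner ℝ ν w) • ν)))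
  rw [dist_eq_norm] at h3
  have h4 := mul_le_mul_of_nonneg_left hproj hL
  have h5 := (abs_le.1 hdn).2
  have h6 : L * (2 * ‖d‖) ≤ L * (2 * (κ * s)) := by gcongr
  nlinarith

/-- The complement of a bounded Lipschitz domain contains balls of comparable size near each of its
points and at every scale. -/
lemma IsBoundedLipschitz.exists_exterior_ball (hn : 0 < n) {Ω : Set (E n)}
    (hΩ : IsBoundedLipschitz Ω) :
    ∃ κ : ℝ, 0 < κ ∧ κ ≤ 1 ∧ ∀ z ∉ Ω, ∀ s : ℝ, 0 < s →
      ∃ y, Metric.ball y (κ * s) ⊆ Metric.ball z s ∩ Ωᶜ := by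
  obtain ⟨hopen, hbdd, hgraph⟩ := hΩ
  obtain ⟨M, hM0, hM⟩ : ∃ M : ℝ, 0 < M ∧ Ω ⊆ Metric.ball 0 M := by
    obtain ⟨M, hM⟩ := hbdd.subset_ball 0
    exact ⟨max M 1, by positivity, hM.trans (Metric.ball_subset_ball (le_max_left _ _))⟩
  -- Boundary points use the graph and exterior points a full ball in the complement; for points of
  -- `Ω` the claim is vacuous.
  have loc : ∀ z : E n, ∃ R > 0, ∃ κ > 0, κ ≤ 1 ∧ (z ∉ Ω → ∀ z' ∈ Metric.ball z R, z' ∉ Ω →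
      ∀ s, 0 < s → s ≤ R → ∃ y, Metric.ball y (κ * s) ⊆ Metric.ball z' s ∩ Ωᶜ) := by
    intro z
    by_cases hz : z ∈ frontier Ω
    · obtain ⟨R, hR, ν, hν, L, γ, hγ, h⟩ := hgraph z hz
      have hL : (0 : ℝ) ≤ L := L.2
      refine ⟨R / 2, by positivity, (4 * (1 + (L : ℝ)))⁻¹, by positivity,
        inv_le_one_of_one_le₀ (by linarith), fun _ z' hz' hz'Ω s hs hsR => ?_⟩
      exact exists_exterior_ball_of_graph hν hγ h hz' hz'Ω hs hsR
    · by_cases hzΩ : z ∈ Ω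
      · exact ⟨1, one_pos, 1, one_pos, le_rfl, fun h => absurd hzΩ h⟩
      have : z ∉ closure Ω := fun h => hz ⟨h, fun h' => hzΩ (interior_subset h')⟩
      obtain ⟨R, hR, h⟩ := Metric.isOpen_iff.1 isClosed_closure.isOpen_compl z this
      refine ⟨R / 2, by positivity, 1, one_pos, le_rfl, fun _ z' hz' _ s hs hsR => ⟨z', ?_⟩⟩
      rw [one_mul]
      refine fun w hw => ⟨hw, fun hwΩ => ?_⟩
      have hwR : w ∈ Metric.ball z R := by
        rw [Metric.mem_ball] at *
        linarith [dist_triangle w z' z]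
      exact h hwR (subset_closure hwΩ)
  choose R hR κ hκ hκ1 hloc using loc
  -- Compactness makes the radius and the ratio uniform over all centres in the large closed ball
  -- outside `Ω`.
  have hcomp : IsCompact (Metric.closedBall (0 : E n) M ∩ Ωᶜ) :=
    (isCompact_closedBall _ _).inter_right hopen.isClosed_compl
  obtain ⟨t, htK, ht⟩ := hcomp.elim_nhds_subcover (fun z => Metric.ball z (R z))
    fun z _ => Metric.ball_mem_nhds z (hR z)
  obtain ⟨R₀, hR₀, hR₀t⟩ : ∃ R₀ > 0, ∀ z ∈ t, R₀ ≤ R z := by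
    clear ht htK
    induction t using Finset.induction_on with
    | empty => exact ⟨1, one_pos, by simp⟩
    | insert a t ha ih =>
      obtain ⟨ρ, hρ, h⟩ := ih
      refine ⟨min ρ (R a), lt_min hρ (hR a), fun z hz => ?_⟩
      rcases Finset.mem_insert.1 hz with rfl | hz
      · exact min_le_right _ _
      · exact (min_le_left _ _).trans (h z hz)
  obtain ⟨κ₀, hκ₀, hκ₀1, hκ₀t⟩ : ∃ κ₀ > 0, κ₀ ≤ 1 ∧ ∀ z ∈ t, κ₀ ≤ κ z := by
    clear ht htK hR₀t
    induction t using Finset.induction_on with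
    | empty => exact ⟨1, one_pos, le_rfl, by simp⟩
    | insert a t ha ih =>
      obtain ⟨ρ, hρ, hρ1, h⟩ := ih
      refine ⟨min ρ (κ a), lt_min hρ (hκ a), (min_le_left _ _).trans hρ1, fun z hz => ?_⟩
      rcases Finset.mem_insert.1 hz with rfl | hz
      · exact min_le_right _ _
      · exact (min_le_left _ _).trans (h z hz)
  have small : ∀ z ∈ Metric.closedBall (0 : E n) M, z ∉ Ω → ∀ s, 0 < s → s ≤ R₀ →
      ∃ y, Metric.ball y (κ₀ * s) ⊆ Metric.ball z s ∩ Ωᶜ := by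
    intro z hz hzΩ s hs hsR
    obtain ⟨p, hp, hzp⟩ := mem_iUnion₂.1 (ht ⟨hz, hzΩ⟩)
    obtain ⟨y, hy⟩ := hloc p (htK p hp).2 z hzp hzΩ s hs (hsR.trans (hR₀t p hp))
    refine ⟨y, (Metric.ball_subset_ball ?_).trans hy⟩
    gcongr
    exact hκ₀t p hp
  -- Shrinking by `θ` brings every scale up to `4M` below `R₀`. Larger scales need no geometry of
  -- the boundary, since `Ω` lies in the ball of radius `M`.
  set θ : ℝ := min 1 (R₀ / (4 * M)) with hθ
  have hθ0 : 0 < θ := by positivity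
  have hθ1 : θ ≤ 1 := min_le_left _ _
  have hθM : θ * (4 * M) ≤ R₀ := by
    have := min_le_right 1 (R₀ / (4 * M))
    rwa [← hθ, le_div_iff₀ (by positivity)] at this
  refine ⟨min (κ₀ * θ) (1 / 8), by positivity, (min_le_right _ _).trans (by norm_num),
    fun z hzΩ s hs => ?_⟩
  set κ₁ : ℝ := min (κ₀ * θ) (1 / 8) with hκ₁
  have hκ₁a : κ₁ ≤ κ₀ * θ := min_le_left _ _
  have hκ₁b : κ₁ ≤ 1 / 8 := min_le_right _ _
  have hκs : κ₁ * s ≤ s / 8 := by nlinarith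
  have far : ∀ w : E n, M ≤ ‖w‖ → w ∈ Ωᶜ := fun w hw h => by
    have := mem_ball_zero_iff.1 (hM h)
    linarith
  by_cases hzM : ‖z‖ ≤ M
  · by_cases hsM : s ≤ 4 * M
    · obtain ⟨y, hy⟩ := small z (mem_closedBall_zero_iff.2 hzM) hzΩ (θ * s) (by positivity)
        ((mul_le_mul_of_nonneg_left hsM hθ0.le).trans hθM)
      refine ⟨y, (Metric.ball_subset_ball ?_).trans (hy.trans (inter_subset_inter_left _
        (Metric.ball_subset_ball (mul_le_of_le_one_left hs.le hθ1))))⟩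
      rw [← mul_assoc]
      gcongr
    · rw [not_le] at hsM
      have he : ‖(EuclideanSpace.single (⟨0, hn⟩ : Fin n) (1 : ℝ) : E n)‖ = 1 := by simp
      set e : E n := EuclideanSpace.single (⟨0, hn⟩ : Fin n) (1 : ℝ)
      -- With `‖z‖ ≤ M < s/4` and ball radius at most `s/8`, points here have norm at least `3s/4 -
      -- s/8 - M > M`, and they stay within `7s/8` of `z`.
      refine ⟨z + (3 / 4 * s) • e, fun w hw => ?_⟩
      rw [mem_ball_iff_norm] at hw
      have hse : ‖(3 / 4 * s) • e‖ = 3 / 4 * s := by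
        rw [norm_smul, he, mul_one, Real.norm_of_nonneg (by positivity)]
      refine ⟨?_, far w ?_⟩
      · rw [mem_ball_iff_norm]
        have : w - z = (w - (z + (3 / 4 * s) • e)) + (3 / 4 * s) • e := by abel
        rw [this]
        exact (norm_add_le _ _).trans_lt (by rw [hse]; linarith)
      · have : (3 / 4 * s) • e = w - (w - (z + (3 / 4 * s) • e)) - z := by abel
        have h1 : 3 / 4 * s ≤ ‖w‖ + ‖w - (z + (3 / 4 * s) • e)‖ + ‖z‖ := by
          have h2 := norm_sub_le (w - (w - (z + (3 / 4 * s) • e))) z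
          rw [← this, hse] at h2
          linarith [norm_sub_le w (w - (z + (3 / 4 * s) • e))]
        linarith
  · rw [not_le] at hzM
    have hz0 : 0 < ‖z‖ := hM0.trans hzM
    set e : E n := ‖z‖⁻¹ • z with he
    have he1 : ‖e‖ = 1 := by rw [he, norm_smul, norm_inv, norm_norm, inv_mul_cancel₀ hz0.ne']
    have hze : z = ‖z‖ • e := by rw [he, smul_smul, mul_inv_cancel₀ hz0.ne', one_smul]
    -- Moving radially outwards raises the norm by `s/2`, more than the radius `s/8` can undo.
    refine ⟨z + (s / 2) • e, fun w hw => ?_⟩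
    rw [mem_ball_iff_norm] at hw
    have hse : ‖(s / 2) • e‖ = s / 2 := by
      rw [norm_smul, he1, mul_one, Real.norm_of_nonneg (by positivity)]
    refine ⟨?_, far w ?_⟩
    · rw [mem_ball_iff_norm]
      have : w - z = (w - (z + (s / 2) • e)) + (s / 2) • e := by abel
      rw [this]
      exact (norm_add_le _ _).trans_lt (by rw [hse]; linarith)
    · have h1 : ‖z + (s / 2) • e‖ = ‖z‖ + s / 2 := by
        nth_rewrite 1 [hze]
        rw [← add_smul, norm_smul, he1, mul_one, Real.norm_of_nonneg (by positivity)]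
      have h2 : ‖z + (s / 2) • e‖ ≤ ‖w‖ + ‖w - (z + (s / 2) • e)‖ := by
        have : z + (s / 2) • e = w - (w - (z + (s / 2) • e)) := by abel
        exact (congrArg norm this).trans_le (norm_sub_le _ _)
      linarith

end LipTrunc

namespace LipTrunc

variable {n : ℕ}

/-! ### Convolution with an even kernel of mass one -/

/-- A continuous, non-negative, even kernel of mass one supported in the ball of radius `ε`. -/
structure IsKernel (κ : E n → ℝ) (ε : ℝ) : Prop where
  continuous : Continuous κ
  nonneg : ∀ x, 0 ≤ κ x
  even : ∀ x, κ (-x) = κ x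
  eq_zero : ∀ x, ε < ‖x‖ → κ x = 0
  integral_eq_one : ∫ x, κ x = 1

lemma IsMollifier.isKernel_rescale {φ : E n → ℝ} (hφ : IsMollifier φ) {ε : ℝ} (hε : 0 < ε) :
    IsKernel (rescale φ ε) ε where
  continuous := continuous_const.mul (hφ.smooth.continuous.comp (continuous_const_smul _))
  nonneg x := mul_nonneg (by positivity) (hφ.nonneg _)
  even x := by
    unfold rescale
    rw [hφ.radial _ (ε⁻¹ • x) (by simp)]
  eq_zero x hx := by
    have h0 : φ (ε⁻¹ • x) = 0 := image_eq_zero_of_notMem_tsupport fun h => by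
      have h1 := mem_closedBall_zero_iff.1 (hφ.tsupport_subset h)
      rw [norm_smul, norm_inv, Real.norm_of_nonneg hε.le, inv_mul_le_iff₀ hε] at h1
      linarith
    rw [rescale, h0, mul_zero]
  integral_eq_one := by
    unfold rescale
    rw [integral_const_mul, Measure.integral_comp_inv_smul_of_nonneg _ _ hε.le,
      hφ.integral_eq_one]
    simp [(pow_pos hε n).ne']

section Kernel

variable {κ : E n → ℝ} {ε : ℝ} {F : Type*} [NormedAddCommGroup F] [NormedSpace ℝ F]

lemma IsKernel.integrable (hκ : IsKernel κ ε) : Integrable κ := by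
  by_contra h
  have := hκ.integral_eq_one
  simp [integral_undef h] at this

lemma IsKernel.hasCompactSupport (hκ : IsKernel κ ε) : HasCompactSupport κ :=
  HasCompactSupport.intro (isCompact_closedBall (0 : E n) ε) fun x hx =>
    hκ.eq_zero x (by simpa using hx)

lemma IsKernel.norm_convolution_le (hκ : IsKernel κ ε) {g : E n → F} {C : ℝ}
    (hg : ∀ᵐ x, ‖g x‖ ≤ C) (x : E n) :
    ‖(κ ⋆[ContinuousLinearMap.lsmul ℝ ℝ, volume] g) x‖ ≤ C :=
  norm_convolution_le_of_bound hκ.nonneg hκ.integral_eq_one hg x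

lemma IsKernel.convolution_eq_zero (hκ : IsKernel κ ε) {g : E n → F} {x : E n}
    (h : ∀ y, ‖y‖ ≤ ε → g (x - y) = 0) :
    (κ ⋆[ContinuousLinearMap.lsmul ℝ ℝ, volume] g) x = 0 := by
  rw [convolution_def]
  refine (integral_congr_ae (ae_of_all _ fun y => ?_)).trans (integral_zero _ _)
  by_cases hy : ‖y‖ ≤ ε
  · simp [h y hy]
  · simp [hκ.eq_zero y (not_le.1 hy)]

lemma IsKernel.contDiff_convolution (hκ : IsKernel κ ε) [CompleteSpace F] {ψ : E n → F}
    (h1 : ContDiff ℝ 1 ψ) (h2 : HasCompactSupport ψ) :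
    ContDiff ℝ 1 (κ ⋆[ContinuousLinearMap.lsmul ℝ ℝ, volume] ψ) :=
  h2.contDiff_convolution_right (n := 1) _ hκ.integrable.locallyIntegrable h1

lemma IsKernel.continuous_convolution (hκ : IsKernel κ ε) {ψ : E n → F}
    (h1 : Continuous ψ) (h2 : HasCompactSupport ψ) :
    Continuous (κ ⋆[ContinuousLinearMap.lsmul ℝ ℝ, volume] ψ) :=
  h2.continuous_convolution_right _ hκ.integrable.locallyIntegrable h1

lemma IsKernel.hasCompactSupport_convolution (hκ : IsKernel κ ε) {ψ : E n → F}
    (h2 : HasCompactSupport ψ) :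
    HasCompactSupport (κ ⋆[ContinuousLinearMap.lsmul ℝ ℝ, volume] ψ) :=
  HasCompactSupport.convolution _ hκ.hasCompactSupport h2

lemma IsKernel.integrable_convolution (hκ : IsKernel κ ε) {f : E n → F} (hf : Integrable f) :
    Integrable (κ ⋆[ContinuousLinearMap.lsmul ℝ ℝ, volume] f) :=
  Integrable.integrable_convolution _ hκ.integrable hf

lemma IsKernel.integral_norm_convolution_le (hκ : IsKernel κ ε) {f : E n → ℝ}
    (hf : Integrable f) :
    ∫ x, ‖(κ ⋆[ContinuousLinearMap.lsmul ℝ ℝ, volume] f) x‖ ≤ ∫ x, ‖f x‖ := by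
  have h1 : ∫ x, (κ ⋆[ContinuousLinearMap.lsmul ℝ ℝ, volume] fun y => ‖f y‖) x = ∫ x, ‖f x‖ := by
    rw [integral_convolution _ hκ.integrable hf.norm, hκ.integral_eq_one]
    simp
  rw [← h1]
  refine integral_mono (hκ.integrable_convolution hf).norm (hκ.integrable_convolution hf.norm)
    fun x => ?_
  refine (norm_integral_le_integral_norm _).trans_eq (integral_congr_ae (ae_of_all _ fun t => ?_))
  simp [abs_of_nonneg (hκ.nonneg t)]

/-- The divergence commutes with convolution. -/
lemma IsKernel.divergence_convolution (hκ : IsKernel κ ε) {ψ : E n → E n}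
    (h1 : ContDiff ℝ 1 ψ) (h2 : HasCompactSupport ψ) :
    divergence (κ ⋆[ContinuousLinearMap.lsmul ℝ ℝ, volume] ψ) =
      κ ⋆[ContinuousLinearMap.lsmul ℝ ℝ, volume] divergence ψ := by
  ext x
  -- The divergence is the trace of the derivative; as a continuous linear map the trace commutes
  -- with the integral defining the convolution.
  let T : (E n →L[ℝ] E n) →L[ℝ] ℝ := ∑ i : Fin n, (EuclideanSpace.proj (𝕜 := ℝ) i) ∘L
    (ContinuousLinearMap.apply ℝ (E n) (EuclideanSpace.single i (1 : ℝ)))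
  have hT : ∀ L : E n →L[ℝ] E n, T L = ∑ i, L (EuclideanSpace.single i 1) i := by
    intro L
    simp [T]
  have hd := (h2.hasFDerivAt_convolution_right (ContinuousLinearMap.lsmul ℝ ℝ)
    hκ.integrable.locallyIntegrable h1 x).fderiv
  have hc : ∀ x, divergence ψ x = T (fderiv ℝ ψ x) := fun x => (hT _).symm
  have hcont := h1.continuous_fderiv one_ne_zero
  change ∑ i, _ = _
  rw [hd, ← hT, convolution_def, convolution_def]
  have e : ∀ t, ((ContinuousLinearMap.lsmul ℝ ℝ).precompR (E n) (κ t)) (fderiv ℝ ψ (x - t)) =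
      κ t • fderiv ℝ ψ (x - t) := by
    intro t
    ext v
    simp [ContinuousLinearMap.precompR_apply]
  simp only [e]
  rw [← T.integral_comp_comm]
  · simp [hc]
  · obtain ⟨C, hC⟩ := (h2.fderiv (𝕜 := ℝ)).exists_bound_of_continuous hcont
    exact hκ.integrable.smul_bdd C (hcont.comp (continuous_const.sub continuous_id)).aestronglyMeasurable
      (ae_of_all _ fun t => hC _)

/-- Convolution with an even kernel is self-adjoint. -/
lemma IsKernel.integral_convolution_mul (hκ : IsKernel κ ε) {f g : E n → ℝ} (hf : Integrable f)
    (hg : Continuous g) {C : ℝ} (hC : ∀ x, ‖g x‖ ≤ C) :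
    ∫ x, (κ ⋆[ContinuousLinearMap.lsmul ℝ ℝ, volume] f) x * g x =
      ∫ x, f x * (κ ⋆[ContinuousLinearMap.lsmul ℝ ℝ, volume] g) x := by
  have h0 : Integrable (fun p : E n × E n => f p.2 * κ (p.1 - p.2)) (volume.prod volume) :=
    hf.convolution_integrand (ContinuousLinearMap.mul ℝ ℝ) hκ.integrable
  have h1 : Integrable (fun p : E n × E n => f p.2 * κ (p.1 - p.2) * g p.1)
      (volume.prod volume) :=
    h0.mul_bdd (c := C) (hg.comp continuous_fst).aestronglyMeasurable (ae_of_all _ fun p => hC p.1)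
  have e1 : ∀ x, (κ ⋆[ContinuousLinearMap.lsmul ℝ ℝ, volume] f) x * g x =
      ∫ t, f t * κ (x - t) * g x := by
    intro x
    rw [convolution_eq_swap, ← integral_mul_const]
    simp [mul_comm]
  have e2 : ∀ t, f t * (κ ⋆[ContinuousLinearMap.lsmul ℝ ℝ, volume] g) t =
      ∫ x, f t * κ (x - t) * g x := by
    intro t
    rw [convolution_eq_swap, ← integral_const_mul]
    refine integral_congr_ae (ae_of_all _ fun x => ?_)
    -- Evenness makes the kernel symmetric in the two variables, so Fubini yields self-adjointness.
    have : κ (t - x) = κ (x - t) := by rw [← hκ.even, neg_sub]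
    simp [this, mul_assoc]
  simp only [e1, e2]
  exact integral_integral_swap h1

/-- A bound on translation errors passes to convolutions. -/
lemma IsKernel.abs_integral_convolution_sub_le (hκ : IsKernel κ ε) [CompleteSpace F]
    {B : E n → F →L[ℝ] ℝ} (hB : Integrable B) {ψ : E n → F} (h1 : Continuous ψ)
    (h2 : HasCompactSupport ψ) {M : ℝ}
    (hM : ∀ y, ‖y‖ ≤ ε → |(∫ x, B x (ψ (x - y))) - ∫ x, B x (ψ x)| ≤ M) :
    |(∫ x, B x ((κ ⋆[ContinuousLinearMap.lsmul ℝ ℝ, volume] ψ) x)) - ∫ x, B x (ψ x)| ≤ M := by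
  obtain ⟨C, hC⟩ := h2.exists_bound_of_continuous h1
  have hmeas : AEStronglyMeasurable (fun p : E n × E n => κ p.2 * B p.1 (ψ (p.1 - p.2)))
      (volume.prod volume) := by
    refine AEStronglyMeasurable.mul
      (hκ.continuous.comp continuous_snd).aestronglyMeasurable ?_
    exact (ContinuousLinearMap.id ℝ (F →L[ℝ] ℝ)).aestronglyMeasurable_comp₂
      hB.aestronglyMeasurable.comp_fst
      (h1.comp (continuous_fst.sub continuous_snd)).aestronglyMeasurable
  have hint : Integrable (fun p : E n × E n => κ p.2 * B p.1 (ψ (p.1 - p.2)))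
      (volume.prod volume) := by
    refine ((hB.norm.mul_prod hκ.integrable).mul_const C).mono' hmeas (ae_of_all _ fun p => ?_)
    rw [norm_mul, Real.norm_of_nonneg (hκ.nonneg _)]
    calc κ p.2 * ‖B p.1 (ψ (p.1 - p.2))‖ ≤ κ p.2 * (‖B p.1‖ * C) := by
          refine mul_le_mul_of_nonneg_left (((B p.1).le_opNorm _).trans ?_) (hκ.nonneg _)
          gcongr
          exact hC _
      _ = ‖B p.1‖ * κ p.2 * C := by ring
  -- By Fubini the smoothed integral is the `κ`-average of the translated ones; mass one presents
  -- the unsmoothed integral in the same way.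
  have e1 : ∫ x, B x ((κ ⋆[ContinuousLinearMap.lsmul ℝ ℝ, volume] ψ) x) =
      ∫ y, κ y * ∫ x, B x (ψ (x - y)) := by
    have : ∀ x, B x ((κ ⋆[ContinuousLinearMap.lsmul ℝ ℝ, volume] ψ) x) =
        ∫ y, κ y * B x (ψ (x - y)) := by
      intro x
      rw [convolution_def, ← (B x).integral_comp_comm]
      · simp
      · exact hκ.integrable.smul_bdd C (h1.comp (continuous_const.sub continuous_id)).aestronglyMeasurable
          (ae_of_all _ fun t => hC _)
    simp only [this, ← integral_const_mul]
    exact integral_integral_swap hint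
  have e2 : ∫ x, B x (ψ x) = ∫ y, κ y * ∫ x, B x (ψ x) := by
    rw [integral_mul_const, hκ.integral_eq_one, one_mul]
  have hi1 : Integrable fun y => κ y * ∫ x, B x (ψ (x - y)) := by
    have := hint.integral_prod_right
    simpa only [integral_const_mul] using this
  have hi2 : Integrable fun y => κ y * ∫ x, B x (ψ x) := hκ.integrable.mul_const _
  rw [e1, e2, ← integral_sub hi1 hi2]
  have : M = ∫ y, κ y * M := by rw [integral_mul_const, hκ.integral_eq_one, one_mul]
  rw [this, ← Real.norm_eq_abs]
  refine norm_integral_le_of_norm_le (hκ.integrable.mul_const M) (ae_of_all _ fun y => ?_)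
  rw [← mul_sub, norm_mul, Real.norm_of_nonneg (hκ.nonneg y)]
  by_cases hy : ‖y‖ ≤ ε
  · exact mul_le_mul_of_nonneg_left (hM y hy) (hκ.nonneg y)
  · simp [hκ.eq_zero y (not_le.1 hy)]

end Kernel

end LipTrunc

namespace LipTrunc

variable {n : ℕ}

/-! ### Integration by parts with a constant subtracted -/

lemma integrable_sub_const_smul {F : Type*} [NormedAddCommGroup F] [NormedSpace ℝ F] {u : E n → ℝ}
    (hu : Integrable u) (m : ℝ) {g : E n → F} (hg : Continuous g) (hc : HasCompactSupport g) :
    Integrable fun x => (u x - m) • g x := by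
  obtain ⟨C, hC⟩ := hc.exists_bound_of_continuous hg
  have h1 : Integrable fun x => u x • g x :=
    hu.smul_bdd C hg.aestronglyMeasurable (ae_of_all _ hC)
  have h2 : Integrable fun x => m • g x := (hg.integrable_of_hasCompactSupport hc).smul m
  simp only [sub_smul]
  exact h1.sub h2

lemma integrable_sub_const_mul {u : E n → ℝ} (hu : Integrable u) (m : ℝ) {g : E n → ℝ}
    (hg : Continuous g) (hc : HasCompactSupport g) : Integrable fun x => (u x - m) * g x :=
  integrable_sub_const_smul hu m hg hc

lemma integral_fderiv_eq_zero {g : E n → ℝ} (hg : ContDiff ℝ 1 g) (hc : HasCompactSupport g)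
    (e : E n) : ∫ x, fderiv ℝ g x e = 0 := by
  have h1 : Integrable fun x => fderiv ℝ g x e :=
    ((hg.continuous_fderiv one_ne_zero).clm_apply
      continuous_const).integrable_of_hasCompactSupport (hc.fderiv_apply ℝ e)
  have h2 : Integrable g := hg.continuous.integrable_of_hasCompactSupport hc
  have := integral_mul_fderiv_eq_neg_fderiv_mul_of_integrable (μ := volume) (f := fun _ : E n => (1 : ℝ))
    (g := g) (v := e) (by simp) (by simpa using h1) (by simpa using h2)
    (fun x _ => differentiableAt_const _) (fun x _ => hg.differentiable one_ne_zero x)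
  simpa using this

lemma integral_divergence_eq_zero {X : E n → E n} (h1 : ContDiff ℝ 1 X)
    (h2 : HasCompactSupport X) : ∫ x, divergence X x = 0 := by
  have e : ∀ i x, fderiv ℝ (fun y => X y i) x = (EuclideanSpace.proj (𝕜 := ℝ) i) ∘L fderiv ℝ X x :=
    fun i x => ((EuclideanSpace.proj (𝕜 := ℝ) i).hasFDerivAt.comp x
      (h1.differentiable one_ne_zero x).hasFDerivAt).fderiv
  have hi : ∀ i, ContDiff ℝ 1 fun y => X y i := fun i =>
    (EuclideanSpace.proj (𝕜 := ℝ) i).contDiff.comp h1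
  have hc : ∀ i, HasCompactSupport fun y => X y i := fun i =>
    h2.comp_left (g := fun v : E n => v i) rfl
  have hd : ∀ x, divergence X x = ∑ i, fderiv ℝ (fun y => X y i) x (EuclideanSpace.single i 1) := by
    intro x
    simp only [divergence, e]
    rfl
  simp only [hd]
  rw [integral_finsetSum]
  · exact Finset.sum_eq_zero fun i _ => integral_fderiv_eq_zero (hi i) (hc i) _
  · intro i _
    exact (((hi i).continuous_fderiv one_ne_zero).clm_apply
      continuous_const).integrable_of_hasCompactSupport ((hc i).fderiv_apply ℝ _)

/-- A divergence of compact support has integral zero, so any constant may be subtracted from `u`.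
Integrability of `u - m` over the whole space is not needed. -/
lemma integral_sub_const_mul_divergence {u : E n → ℝ} (hu : Integrable u)
    {μ : VectorMeasure (E n) (E n)} (hμ : IsDistribGrad u μ) (m : ℝ) {X : E n → E n}
    (h1 : ContDiff ℝ 1 X) (h2 : HasCompactSupport X) :
    ∫ x, (u x - m) * divergence X x = -pairing μ X := by
  have hd := continuous_divergence h1
  have hc := hasCompactSupport_divergence h2
  have i1 := integrable_mul_continuous_compact hu hd hc
  have i2 : Integrable fun x => m * divergence X x :=
    (hd.integrable_of_hasCompactSupport hc).const_mul m
  simp only [sub_mul]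
  rw [integral_sub i1 i2, integral_const_mul, integral_divergence_eq_zero h1 h2, hμ X h1 h2]
  ring

/-- The divergence of a product. -/
lemma divergence_smul {η : E n → ℝ} {X : E n → E n} {x : E n} (hη : DifferentiableAt ℝ η x)
    (hX : DifferentiableAt ℝ X x) :
    divergence (fun y => η y • X y) x = η x * divergence X x + fderiv ℝ η x (X x) := by
  unfold divergence
  rw [fderiv_fun_smul hη hX, ← sum_mul_coord (fderiv ℝ η x) (X x), Finset.mul_sum,
    ← Finset.sum_add_distrib]
  simp

section Correction

variable {κ : E n → ℝ} {ε : ℝ} {u : E n → ℝ} {μ : VectorMeasure (E n) (E n)} {η : E n → ℝ}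

/-- The defect of a field under smoothing. -/
noncomputable def defect (κ : E n → ℝ) (ψ : E n → E n) (x : E n) : E n :=
  ψ x - (κ ⋆[ContinuousLinearMap.lsmul ℝ ℝ, volume] ψ) x

lemma IsKernel.contDiff_defect (hκ : IsKernel κ ε) {ψ : E n → E n} (h1 : ContDiff ℝ 1 ψ)
    (h2 : HasCompactSupport ψ) : ContDiff ℝ 1 (defect κ ψ) :=
  h1.sub (hκ.contDiff_convolution h1 h2)

lemma IsKernel.hasCompactSupport_defect (hκ : IsKernel κ ε) {ψ : E n → E n}
    (h2 : HasCompactSupport ψ) : HasCompactSupport (defect κ ψ) :=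
  h2.sub (hκ.hasCompactSupport_convolution h2)

lemma IsKernel.continuous_defect (hκ : IsKernel κ ε) {ψ : E n → E n} (h1 : Continuous ψ)
    (h2 : HasCompactSupport ψ) : Continuous (defect κ ψ) :=
  h1.sub (hκ.continuous_convolution h1 h2)

lemma IsKernel.norm_defect_le (hκ : IsKernel κ ε) {ψ : E n → E n} {C : ℝ} (hC : ∀ x, ‖ψ x‖ ≤ C)
    (x : E n) : ‖defect κ ψ x‖ ≤ 2 * C := by
  refine (norm_sub_le _ _).trans ?_
  linarith [hC x, hκ.norm_convolution_le (ae_of_all _ hC) x]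

lemma IsKernel.divergence_defect (hκ : IsKernel κ ε) {ψ : E n → E n} (h1 : ContDiff ℝ 1 ψ)
    (h2 : HasCompactSupport ψ) (x : E n) :
    divergence (defect κ ψ) x =
      divergence ψ x - (κ ⋆[ContinuousLinearMap.lsmul ℝ ℝ, volume] divergence ψ) x := by
  rw [← hκ.divergence_convolution h1 h2]
  have : defect κ ψ = ψ - (κ ⋆[ContinuousLinearMap.lsmul ℝ ℝ, volume] ψ) := rfl
  unfold divergence
  rw [this, fderiv_sub (h1.differentiable one_ne_zero x)
    ((hκ.contDiff_convolution h1 h2).differentiable one_ne_zero x), ← Finset.sum_sub_distrib]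
  simp

/-- The pairing of a local correction with a divergence. -/
lemma integral_correction_mul_divergence (hκ : IsKernel κ ε) (hu : Integrable u)
    (hμ : IsDistribGrad u μ) (m : ℝ) (hη : ContDiff ℝ 2 η) (hηc : HasCompactSupport η)
    {ψ : E n → E n} (h1 : ContDiff ℝ 1 ψ) (h2 : HasCompactSupport ψ) :
    ∫ x, (η x * (u x - m)
        - (κ ⋆[ContinuousLinearMap.lsmul ℝ ℝ, volume] fun y => η y * (u y - m)) x) *
          divergence ψ x =
      -pairing μ (fun x => η x • defect κ ψ x)
        - ∫ x, (u x - m) * fderiv ℝ η x (defect κ ψ x) := by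
  have hη1 : ContDiff ℝ 1 η := hη.of_le (by norm_num)
  have hd := continuous_divergence h1
  have hc := hasCompactSupport_divergence h2
  obtain ⟨C, hC⟩ := hc.exists_bound_of_continuous hd
  have hf : Integrable fun y => η y * (u y - m) := by
    simpa only [mul_comm] using integrable_sub_const_mul hu m hη.continuous hηc
  have hZ1 := hκ.contDiff_defect h1 h2
  have hZ2 := hκ.hasCompactSupport_defect h2
  have hdZ := continuous_divergence hZ1
  have i1 : Integrable fun x => η x * (u x - m) * divergence ψ x :=
    hf.mul_bdd hd.aestronglyMeasurable (ae_of_all _ hC)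
  have i2 : Integrable fun x =>
      (κ ⋆[ContinuousLinearMap.lsmul ℝ ℝ, volume] fun y => η y * (u y - m)) x * divergence ψ x :=
    (hκ.integrable_convolution hf).mul_bdd hd.aestronglyMeasurable (ae_of_all _ hC)
  have i3 : Integrable fun x => η x * (u x - m) *
      (κ ⋆[ContinuousLinearMap.lsmul ℝ ℝ, volume] divergence ψ) x :=
    hf.mul_bdd (hκ.continuous_convolution hd hc).aestronglyMeasurable
      (ae_of_all _ (hκ.norm_convolution_le (ae_of_all _ hC)))
  have i4 : Integrable fun x => (u x - m) * divergence (fun y => η y • defect κ ψ y) x :=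
    integrable_sub_const_mul hu m (continuous_divergence (hη1.smul hZ1))
      (hasCompactSupport_divergence hηc.smul_right)
  have i5 : Integrable fun x => (u x - m) * fderiv ℝ η x (defect κ ψ x) := by
    refine integrable_sub_const_mul hu m
      ((hη1.continuous_fderiv one_ne_zero).clm_apply hZ1.continuous) ?_
    refine (hηc.fderiv (𝕜 := ℝ)).mono fun x hx h0 => hx ?_
    simp [h0]
  have hX1 : ContDiff ℝ 1 fun x => η x • defect κ ψ x := hη1.smul hZ1
  have e : ∀ x, (η x * (u x - m)
      - (κ ⋆[ContinuousLinearMap.lsmul ℝ ℝ, volume] fun y => η y * (u y - m)) x) *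
        divergence ψ x = η x * (u x - m) * divergence ψ x -
      (κ ⋆[ContinuousLinearMap.lsmul ℝ ℝ, volume] fun y => η y * (u y - m)) x *
        divergence ψ x := fun x => sub_mul _ _ _
  simp only [e]
  -- The convolution passes to `div ψ`, producing the divergence of the defect `Z`; then `η div Z =
  -- div (η Z) - ∇η · Z`.
  rw [integral_sub i1 i2, hκ.integral_convolution_mul hf hd hC, ← integral_sub i1 i3,
    ← integral_sub_const_mul_divergence hu hμ m hX1 hηc.smul_right,
    ← integral_sub i4 i5]
  refine integral_congr_ae (ae_of_all _ fun x => ?_)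
  simp only
  rw [divergence_smul (hη1.differentiable one_ne_zero x) (hZ1.differentiable one_ne_zero x),
    hκ.divergence_defect h1 h2]
  ring

/-- The error caused by the gradient of the cutoff function. -/
lemma abs_integral_fderiv_cutoff_le (hκ : IsKernel κ ε) (hε : 0 ≤ ε) (hu : Integrable u)
    (hμ : IsDistribGrad u μ) (m : ℝ) (hη : ContDiff ℝ 2 η) (hηc : HasCompactSupport η)
    {A : Set (E n)} (hA : MeasurableSet A) (hAfin : volume A ≠ ⊤)
    (hη1 : ∀ x ∉ A, fderiv ℝ η x = 0)
    (hη2 : ∀ x ∉ A, fderiv ℝ (fderiv ℝ η) x = 0) {K₁ K₂ : ℝ} (hK₁ : ∀ x, ‖fderiv ℝ η x‖ ≤ K₁)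
    (hK₂ : ∀ x, ‖fderiv ℝ (fderiv ℝ η) x‖ ≤ K₂)
    {ψ : E n → E n} (h1 : ContDiff ℝ 1 ψ) (h2 : HasCompactSupport ψ) {C : ℝ}
    (hC : ∀ x, ‖ψ x‖ ≤ C) :
    |∫ x, (u x - m) * fderiv ℝ η x (defect κ ψ x)| ≤
      ε * (K₁ * μ.variation.real A + K₂ * ∫ x in A, |u x - m|) * C := by
  have hC0 : 0 ≤ C := (norm_nonneg _).trans (hC 0)
  have hK₁0 : 0 ≤ K₁ := (norm_nonneg _).trans (hK₁ 0)
  have hK₂0 : 0 ≤ K₂ := (ContinuousLinearMap.opNorm_nonneg _).trans (hK₂ 0)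
  have hdη : ContDiff ℝ 1 (fderiv ℝ η) := hη.fderiv_right (by norm_num)
  have hddη := hdη.continuous_fderiv one_ne_zero
  have hdηc : HasCompactSupport (fderiv ℝ η) := hηc.fderiv (𝕜 := ℝ)
  have hB : Integrable fun x => (u x - m) • fderiv ℝ η x :=
    integrable_sub_const_smul hu m hdη.continuous hdηc
  have hwA : IntegrableOn (fun x => |u x - m|) A :=
    (hu.integrableOn.sub (integrableOn_const hAfin)).norm
  have hI0 : 0 ≤ ∫ x in A, |u x - m| := integral_nonneg fun x => abs_nonneg _
  -- It suffices to treat a single shift of length at most `ε`, and then, by Taylor, the derivative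
  -- of `ψ` along that shift.
  have key := hκ.abs_integral_convolution_sub_le hB h1.continuous h2
    (M := ε * (K₁ * μ.variation.real A + K₂ * ∫ x in A, |u x - m|) * C) ?_
  · have i1 : Integrable fun x => ((u x - m) • fderiv ℝ η x) (ψ x) := by
      refine integrable_sub_const_smul hu m (hdη.continuous.clm_apply h1.continuous) ?_
      exact hdηc.mono fun x hx h0 => hx (by simp [h0])
    have i2 : Integrable fun x => ((u x - m) • fderiv ℝ η x)
        ((κ ⋆[ContinuousLinearMap.lsmul ℝ ℝ, volume] ψ) x) := by
      refine integrable_sub_const_smul hu m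
        (hdη.continuous.clm_apply (hκ.continuous_convolution h1.continuous h2)) ?_
      exact hdηc.mono fun x hx h0 => hx (by simp [h0])
    rw [abs_sub_comm, ← integral_sub i1 i2] at key
    refine (congrArg abs (integral_congr_ae (ae_of_all _ fun x => ?_))).trans_le key
    simp only [defect, map_sub, smul_apply, smul_eq_mul]
    ring
  intro y hy
  refine abs_integral_translate_sub_le hB h1 h2 y fun s hs => ?_
  have hψs : ContDiff ℝ 1 fun x => ψ (x - s • y) := h1.comp (contDiff_id.sub contDiff_const)
  -- By the product rule `∇η · ∂_y ψ` is `∂_y g` minus `D²η(y, ψ)`. Integrating `∂_y g` by parts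
  -- against `u - m` gives a pairing with the gradient measure, so no derivative of `ψ` survives.
  set g : E n → ℝ := fun x => fderiv ℝ η x (ψ (x - s • y)) with hg
  have hg1 : ContDiff ℝ 1 g := hdη.clm_apply hψs
  have hgc : HasCompactSupport g := hdηc.mono fun x hx h0 => hx (by simp [hg, h0])
  have hgd : ∀ x, fderiv ℝ g x y =
      fderiv ℝ (fderiv ℝ η) x y (ψ (x - s • y)) + fderiv ℝ η x (fderiv ℝ ψ (x - s • y) y) := by
    intro x
    have h := fderiv_clm_apply (hdη.differentiable one_ne_zero x)
      (hψs.differentiable one_ne_zero x)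
    rw [hg, h]
    simp [fderiv_comp_sub, add_comm]
  obtain ⟨hX1, hX2⟩ := isTestField_smul hg1 hgc y
  have hdiv := integral_sub_const_mul_divergence hu hμ m hX1 hX2
  simp only [divergence_smul_const (hg1.differentiable one_ne_zero _), hgd] at hdiv
  have hcD2 : Continuous fun x => fderiv ℝ (fderiv ℝ η) x y (ψ (x - s • y)) :=
    (hddη.clm_apply continuous_const).clm_apply hψs.continuous
  have i3 : Integrable fun x => (u x - m) * fderiv ℝ (fderiv ℝ η) x y (ψ (x - s • y)) := by
    refine integrable_sub_const_mul hu m hcD2 ?_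
    exact (hdηc.fderiv (𝕜 := ℝ)).mono fun x hx h0 => hx (by simp [h0])
  have i4 : Integrable fun x => (u x - m) * fderiv ℝ η x (fderiv ℝ ψ (x - s • y) y) := by
    refine integrable_sub_const_mul hu m (hdη.continuous.clm_apply
      ((continuous_comp_sub (h1.continuous_fderiv one_ne_zero) _).clm_apply continuous_const)) ?_
    exact hdηc.mono fun x hx h0 => hx (by simp [h0])
  simp only [mul_add] at hdiv
  rw [integral_add i3 i4] at hdiv
  have e1 : ∫ x, ((u x - m) • fderiv ℝ η x) (fderiv ℝ ψ (x - s • y) y) =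
      -pairing μ (fun x => g x • y) -
        ∫ x, (u x - m) * fderiv ℝ (fderiv ℝ η) x y (ψ (x - s • y)) := by
    rw [← hdiv]
    simp
  rw [e1]
  have b1 : |pairing μ (fun x => g x • y)| ≤ (K₁ * C * ε) * μ.variation.real A := by
    refine abs_pairing_le hA (fun x => ?_) fun x hx => by simp [hg, hη1 x hx]
    rw [norm_smul]
    have : ‖g x‖ ≤ K₁ * C := ((fderiv ℝ η x).le_opNorm _).trans (by
      gcongr
      · exact hK₁ x
      · exact hC _)
    gcongr
  have b2 : |∫ x, (u x - m) * fderiv ℝ (fderiv ℝ η) x y (ψ (x - s • y))| ≤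
      (K₂ * ε * C) * ∫ x in A, |u x - m| := by
    rw [← integral_const_mul, ← integral_indicator hA, ← Real.norm_eq_abs]
    refine norm_integral_le_of_norm_le ((integrable_indicator_iff hA).2 (hwA.const_mul _))
      (ae_of_all _ fun x => ?_)
    by_cases hx : x ∈ A
    · rw [indicator_of_mem hx, norm_mul, mul_comm, Real.norm_eq_abs (u x - m)]
      refine mul_le_mul_of_nonneg_right ?_ (abs_nonneg _)
      refine ((fderiv ℝ (fderiv ℝ η) x).le_opNorm₂ _ _).trans ?_
      gcongr
      · exact hK₂ x
      · exact hC _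
    · simp [hx, hη2 x hx]
  rw [abs_le] at b1 b2 ⊢
  constructor <;> nlinarith [b1.1, b1.2, b2.1, b2.2]

end Correction

end LipTrunc

namespace LipTrunc

variable {n : ℕ} {O : Set (E n)} {ι : Type} {a : ι → E n} {r : ι → ℝ} {η : ι → E n → ℝ} {K : ℝ}

/-! ### Whitney covers -/

lemma IsWhitneyCover.isOpen (hW : IsWhitneyCover O a r) : IsOpen O := by
  rw [← hW.half_cover]
  exact isOpen_iUnion fun j => isOpen_cube _ _

lemma IsWhitneyCover.four_subset (hW : IsWhitneyCover O a r) (j : ι) :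
    cube (a j) (4 * r j) ⊆ O :=
  (cube_mono _ (by linarith [hW.pos j])).trans (hW.eight_subset j)

lemma IsWhitneyCover.finite_overlap (hW : IsWhitneyCover O a r) (x : E n) :
    {j | x ∈ cube (a j) (4 * r j)}.Finite :=
  finite_of_encard_le_coe (hW.overlap x)

/-- The bounded overlap of the cubes, integrated against a measure. -/
lemma IsWhitneyCover.tsum_measure_le [Countable ι] (hW : IsWhitneyCover O a r)
    (ν : Measure (E n)) :
    ∑' j, ν (cube (a j) (4 * r j)) ≤ 120 ^ n * ν O := by
  have hm : ∀ j, MeasurableSet (cube (a j) (4 * r j)) := fun j => measurableSet_cube _ _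
  calc ∑' j, ν (cube (a j) (4 * r j))
      = ∫⁻ x, ∑' j, (cube (a j) (4 * r j)).indicator 1 x ∂ν := by
        rw [lintegral_tsum fun j => (measurable_one.indicator (hm j)).aemeasurable]
        exact tsum_congr fun j => (lintegral_indicator_one (hm j)).symm
    _ ≤ ∫⁻ x, O.indicator (fun _ => 120 ^ n) x ∂ν := by
        refine lintegral_mono fun x => ?_
        by_cases hx : x ∈ O
        · rw [indicator_of_mem hx]
          -- Read as functions of `j`, the indicators sum to the number of cubes containing `x`.
          have e : ∀ j, (cube (a j) (4 * r j)).indicator (1 : E n → ℝ≥0∞) x =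
              {j | x ∈ cube (a j) (4 * r j)}.indicator (1 : ι → ℝ≥0∞) j := fun j => rfl
          simp only [e]
          rw [← tsum_subtype, Pi.one_def, ENNReal.tsum_const, ENat.card_coe_set_eq, mul_one]
          calc _ ≤ (((120 ^ n : ℕ) : ℕ∞) : ℝ≥0∞) := by exact_mod_cast hW.overlap x
            _ = 120 ^ n := by simp
        · rw [indicator_of_notMem hx]
          refine le_of_eq (ENNReal.tsum_eq_zero.2 fun j => ?_)
          exact indicator_of_notMem (fun h => hx (hW.four_subset j h)) _
    _ = 120 ^ n * ν O := by rw [lintegral_indicator hW.isOpen.measurableSet, setLIntegral_const]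

lemma IsWhitneyCover.summable_measureReal [Countable ι] (hW : IsWhitneyCover O a r)
    (ν : Measure (E n)) [IsFiniteMeasure ν] :
    Summable (fun j => ν.real (cube (a j) (4 * r j))) ∧
      ∑' j, ν.real (cube (a j) (4 * r j)) ≤ 120 ^ n * ν.real O := by
  have h := hW.tsum_measure_le ν
  have hfin : 120 ^ n * ν O ≠ ⊤ := by finiteness
  have hne : ∑' j, ν (cube (a j) (4 * r j)) ≠ ⊤ := ne_top_of_le_ne_top hfin h
  refine ⟨ENNReal.summable_toReal hne, ?_⟩
  have := ENNReal.toReal_mono hfin h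
  rw [ENNReal.tsum_toReal_eq fun j => measure_ne_top _ _] at this
  simpa [measureReal_def] using this

section Partition

lemma IsWhitneyPartition.eq_zero (hP : IsWhitneyPartition K O a r η) (j : ι) {x : E n}
    (hx : x ∉ cube (a j) (3 / 4 * r j)) : η j x = 0 := by
  have := hP.le_indicator j x
  rw [indicator_of_notMem hx] at this
  exact le_antisymm this (hP.nonneg j x)

lemma IsWhitneyPartition.le_one (hP : IsWhitneyPartition K O a r η) (j : ι) (x : E n) :
    η j x ≤ 1 :=
  (hP.le_indicator j x).trans (indicator_le_self' (fun _ _ => zero_le_one) x)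

lemma IsWhitneyPartition.hasCompactSupport (hP : IsWhitneyPartition K O a r η) (j : ι) :
    HasCompactSupport (η j) :=
  HasCompactSupport.intro (isBounded_cube (a j) (3 / 4 * r j)).isCompact_closure fun _ hx =>
    hP.eq_zero j fun h => hx (subset_closure h)

lemma IsWhitneyPartition.contDiff_two (hP : IsWhitneyPartition K O a r η) (j : ι) :
    ContDiff ℝ 2 (η j) :=
  by exact_mod_cast contDiff_infty.1 (hP.smooth j) 2

lemma IsWhitneyPartition.tsupport_subset (hW : IsWhitneyCover O a r)
    (hP : IsWhitneyPartition K O a r η) (j : ι) : tsupport (η j) ⊆ cube (a j) (r j) := by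
  refine (closure_mono fun x hx => ?_).trans
    (closure_cube_subset (a j) (s := 3 / 4 * r j) (by linarith [hW.pos j]))
  by_contra h
  exact hx (hP.eq_zero j h)

lemma IsWhitneyPartition.norm_fderiv_le (hW : IsWhitneyCover O a r)
    (hP : IsWhitneyPartition K O a r η) (j : ι) (x : E n) : ‖fderiv ℝ (η j) x‖ ≤ K / r j := by
  have := hP.deriv_bound j x x x
  rw [le_div_iff₀ (hW.pos j)]
  have h1 : 0 ≤ r j ^ 2 * ‖iteratedFDeriv ℝ 2 (η j) x‖ := by positivity
  linarith [abs_nonneg (η j x)]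

lemma IsWhitneyPartition.norm_fderiv_fderiv_le (hW : IsWhitneyCover O a r)
    (hP : IsWhitneyPartition K O a r η) (j : ι) (x : E n) :
    ‖fderiv ℝ (fderiv ℝ (η j)) x‖ ≤ K / r j ^ 2 := by
  have := hP.deriv_bound j x x x
  have hr := hW.pos j
  have e : ‖fderiv ℝ (fderiv ℝ (η j)) x‖ = ‖iteratedFDeriv ℝ 2 (η j) x‖ := by
    rw [← norm_iteratedFDeriv_one, norm_iteratedFDeriv_fderiv]
  rw [e, le_div_iff₀ (by positivity)]
  have h1 : 0 ≤ r j * ‖fderiv ℝ (η j) x‖ := by positivity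
  linarith [abs_nonneg (η j x)]

lemma IsWhitneyPartition.eq_zero_of_notMem (hW : IsWhitneyCover O a r)
    (hP : IsWhitneyPartition K O a r η) {x : E n} (hx : x ∉ O) (j : ι) : η j x = 0 :=
  hP.eq_zero j fun h => hx (hW.four_subset j (cube_mono _ (by linarith [hW.pos j]) h))

lemma IsWhitneyPartition.finite_support (hW : IsWhitneyCover O a r)
    (hP : IsWhitneyPartition K O a r η) (x : E n) : {j | η j x ≠ 0}.Finite := by
  refine (hW.finite_overlap x).subset fun j hj => ?_
  by_contra h
  exact hj (hP.eq_zero j fun h' => h (cube_mono _ (by linarith [hW.pos j]) h'))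

lemma IsWhitneyPartition.summable_smul {F : Type*} [NormedAddCommGroup F] [NormedSpace ℝ F]
    (hW : IsWhitneyCover O a r) (hP : IsWhitneyPartition K O a r η) (f : ι → F) (x : E n) :
    Summable fun j => η j x • f j := by
  refine summable_of_hasFiniteSupport ((hP.finite_support hW x).subset fun j hj h => hj ?_)
  change η j x • f j = 0
  rw [h, zero_smul]

lemma IsWhitneyPartition.hasSum_indicator (hW : IsWhitneyCover O a r)
    (hP : IsWhitneyPartition K O a r η) (x : E n) :
    HasSum (fun j => η j x) (O.indicator (fun _ => 1) x) := by
  by_cases hx : x ∈ O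
  · rw [indicator_of_mem hx]
    exact hP.sum_eq_one x hx
  · rw [indicator_of_notMem hx]
    have : (fun j => η j x) = fun _ => 0 := funext fun j => hP.eq_zero_of_notMem hW hx j
    rw [this]
    exact hasSum_zero

end Partition

/-! ### The almost dual operator -/

section AlmostDual

variable {φ : E n → ℝ} {t : ℝ}

/-- The kernel attached to a cube. -/
lemma isKernel_cube (hφ : IsMollifier φ) (ht : 0 < t) (hW : IsWhitneyCover O a r) (j : ι) :
    IsKernel (rescale φ (t * (1 / 4) * r j)) (t * (1 / 4) * r j) :=
  hφ.isKernel_rescale (by have := hW.pos j; positivity)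

lemma almostDual_eq (ρ : E n → E n) (x : E n) :
    almostDual φ t r η ρ x =
      ρ x - ∑' j, η j x • defect (rescale φ (t * (1 / 4) * r j)) ρ x := rfl

/-- The almost dual operator does not increase the supremum norm. -/
lemma norm_almostDual_le (hφ : IsMollifier φ) (ht : 0 < t) (hW : IsWhitneyCover O a r)
    (hP : IsWhitneyPartition K O a r η) {ρ : E n → E n} {C : ℝ} (hC : ∀ᵐ x, ‖ρ x‖ ≤ C) {x : E n}
    (hx : ‖ρ x‖ ≤ C) : ‖almostDual φ t r η ρ x‖ ≤ C := by
  by_cases hxO : x ∈ O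
  · have h1 := hP.sum_eq_one x hxO
    have h2 : HasSum (fun j => η j x • ρ x) (ρ x) := by simpa using h1.smul_const (ρ x)
    -- On `O` the weights sum to one, so the terms `η_j ρ` cancel `ρ` and a convex combination of
    -- averages is left.
    have h3 : HasSum (fun j => η j x • mollify φ t (r j) ρ x)
        (almostDual φ t r η ρ x) := by
      have := h2.sub (hP.summable_smul hW
        (fun j => defect (rescale φ (t * (1 / 4) * r j)) ρ x) x).hasSum
      rw [← almostDual_eq] at this
      simp only [defect, smul_sub, sub_sub_cancel] at this
      exact this
    have hb : ∀ j, ‖η j x • mollify φ t (r j) ρ x‖ ≤ η j x * C := by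
      intro j
      rw [norm_smul, Real.norm_of_nonneg (hP.nonneg j x)]
      exact mul_le_mul_of_nonneg_left
        ((isKernel_cube hφ ht hW j).norm_convolution_le hC x) (hP.nonneg j x)
    rw [← h3.tsum_eq]
    refine tsum_of_norm_bounded ?_ hb
    simpa using h1.mul_right C
  · rw [almostDual_eq]
    simpa [hP.eq_zero_of_notMem hW hxO] using hx

lemma eLpNorm_almostDual_le (hφ : IsMollifier φ) (ht : 0 < t) (hW : IsWhitneyCover O a r)
    (hP : IsWhitneyPartition K O a r η) {ρ : E n → E n} (h1 : Continuous ρ)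
    (h2 : HasCompactSupport ρ) :
    eLpNorm (almostDual φ t r η ρ) ⊤ volume ≤ eLpNorm ρ ⊤ volume := by
  have hfin : eLpNorm ρ ⊤ volume ≠ ⊤ := (h1.memLp_top_of_hasCompactSupport h2 _).2.ne
  set C : ℝ := (eLpNorm ρ ⊤ volume).toReal with hCdef
  have hC : ∀ᵐ x, ‖ρ x‖ ≤ C := by
    filter_upwards [ae_le_eLpNormEssSup (f := ρ) (μ := volume)] with x hx
    rw [← eLpNorm_exponent_top] at hx
    have := ENNReal.toReal_mono hfin hx
    rwa [toReal_enorm] at this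
  have : ENNReal.ofReal C = eLpNorm ρ ⊤ volume := ENNReal.ofReal_toReal hfin
  rw [← this, eLpNorm_exponent_top]
  refine eLpNormEssSup_le_of_ae_bound ?_
  filter_upwards [hC] with x hx
  exact norm_almostDual_le hφ ht hW hP hC hx

/-- The infinite sum is a pointwise limit of continuous finite sums along the finite subsets of a
countable index set, which gives measurability; boundedness gives the rest. -/
lemma integrable_almostDual [Countable ι] (hφ : IsMollifier φ) (ht : 0 < t)
    (hW : IsWhitneyCover O a r) (hP : IsWhitneyPartition K O a r η) {ρ : E n → E n}
    (h1 : Continuous ρ) (h2 : HasCompactSupport ρ) (ν : Measure (E n)) [IsFiniteMeasure ν] :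
    Integrable (almostDual φ t r η ρ) ν := by
  obtain ⟨C, hC⟩ := h2.exists_bound_of_continuous h1
  have hcont : ∀ j, Continuous fun x => η j x • defect (rescale φ (t * (1 / 4) * r j)) ρ x :=
    fun j => (hP.smooth j).continuous.smul ((isKernel_cube hφ ht hW j).continuous_defect h1 h2)
  refine Integrable.of_bound (h1.aestronglyMeasurable.sub
    (aestronglyMeasurable_of_tendsto_ae atTop
      (fun s => (continuous_finsetSum s fun j _ => hcont j).aestronglyMeasurable)
      (ae_of_all _ fun x => (hP.summable_smul hW
        (fun j => defect (rescale φ (t * (1 / 4) * r j)) ρ x) x).hasSum))) C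
    (ae_of_all _ fun x => norm_almostDual_le hφ ht hW hP (ae_of_all _ hC) (hC x))

/-- Dominated convergence applies because the norms of the terms sum to at most `2C ∑ η_j`, that is
`2C` on `O` and `0` elsewhere. -/
lemma hasSum_pairing_defect [Countable ι] (hφ : IsMollifier φ) (ht : 0 < t)
    (hW : IsWhitneyCover O a r) (hP : IsWhitneyPartition K O a r η) {ρ : E n → E n}
    (h1 : Continuous ρ) (h2 : HasCompactSupport ρ) (μ : VectorMeasure (E n) (E n)) :
    HasSum (fun j => pairing μ fun x => η j x • defect (rescale φ (t * (1 / 4) * r j)) ρ x)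
      (pairing μ ρ - pairing μ (almostDual φ t r η ρ)) := by
  obtain ⟨C, hC⟩ := h2.exists_bound_of_continuous h1
  have hcont : ∀ j, Continuous fun x => η j x • defect (rescale φ (t * (1 / 4) * r j)) ρ x :=
    fun j => (hP.smooth j).continuous.smul ((isKernel_cube hφ ht hW j).continuous_defect h1 h2)
  have hsum : ∀ x, HasSum (fun j => η j x • defect (rescale φ (t * (1 / 4) * r j)) ρ x)
      (ρ x - almostDual φ t r η ρ x) := by
    intro x
    rw [almostDual_eq, sub_sub_cancel]
    exact (hP.summable_smul hW _ x).hasSum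
  have hρi : Integrable ρ μ.variation :=
    Integrable.of_bound h1.aestronglyMeasurable C (ae_of_all _ hC)
  have hSi := integrable_almostDual hφ ht hW hP h1 h2 μ.variation
  rw [← pairing_sub hρi hSi]
  have htsum : ∀ x, ∑' j, η j x * (2 * C) = O.indicator (fun _ => 2 * C) x := by
    intro x
    rw [tsum_mul_right, (hP.hasSum_indicator hW x).tsum_eq]
    by_cases hx : x ∈ O <;> simp [hx]
  refine VectorMeasure.hasSum_integral_of_dominated_convergence (fun j x => η j x * (2 * C))
    (fun j => (hcont j).aestronglyMeasurable) (fun j => ae_of_all _ fun x => ?_)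
    (ae_of_all _ fun x => (hP.hasSum_indicator hW x).summable.mul_right _) ?_ (ae_of_all _ hsum)
  · rw [norm_smul, Real.norm_of_nonneg (hP.nonneg j x)]
    exact mul_le_mul_of_nonneg_left ((isKernel_cube hφ ht hW j).norm_defect_le hC x) (hP.nonneg j x)
  · simp only [htsum]
    exact (integrable_const _).indicator hW.isOpen.measurableSet

/-- Together with the sup norm bound, this lets the estimate pass from smooth fields to uniform
limits. -/
lemma almostDual_sub (hφ : IsMollifier φ) (ht : 0 < t) (hW : IsWhitneyCover O a r)
    (hP : IsWhitneyPartition K O a r η) {ρ σ : E n → E n} (h1 : Continuous ρ)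
    (h2 : HasCompactSupport ρ) (h3 : Continuous σ) (h4 : HasCompactSupport σ) (x : E n) :
    almostDual φ t r η (fun y => ρ y - σ y) x =
      almostDual φ t r η ρ x - almostDual φ t r η σ x := by
  have hd : ∀ j, defect (rescale φ (t * (1 / 4) * r j)) (fun y => ρ y - σ y) x =
      defect (rescale φ (t * (1 / 4) * r j)) ρ x - defect (rescale φ (t * (1 / 4) * r j)) σ x := by
    intro j
    have hκ := isKernel_cube hφ ht hW j
    have e1 := (h2.convolutionExists_right (ContinuousLinearMap.lsmul ℝ ℝ)
      hκ.integrable.locallyIntegrable h1) x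
    have e2 := (h4.convolutionExists_right (ContinuousLinearMap.lsmul ℝ ℝ)
      hκ.integrable.locallyIntegrable h3) x
    have e3 : (rescale φ (t * (1 / 4) * r j) ⋆[ContinuousLinearMap.lsmul ℝ ℝ, volume]
        fun y => ρ y - σ y) x =
        (rescale φ (t * (1 / 4) * r j) ⋆[ContinuousLinearMap.lsmul ℝ ℝ, volume] ρ) x -
        (rescale φ (t * (1 / 4) * r j) ⋆[ContinuousLinearMap.lsmul ℝ ℝ, volume] σ) x := by
      simp only [convolution_def, map_sub]
      exact integral_sub e1 e2
    simp only [defect, e3]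
    abel
  simp only [almostDual_eq, hd, smul_sub]
  rw [(hP.summable_smul hW _ x).tsum_sub (hP.summable_smul hW _ x)]
  abel

end AlmostDual

end LipTrunc

namespace LipTrunc

variable {n : ℕ} {O Ω : Set (E n)} {ι : Type} {a : ι → E n} {r : ι → ℝ} {η : ι → E n → ℝ} {K : ℝ}
  {φ : E n → ℝ} {t : ℝ} {u : E n → ℝ} {θ : ℝ}

/-! ### Local means -/

/-- The complement of `Ω` contains balls of radius `θ s` in every ball of radius `s` centred
outside `Ω`. -/
def HasExteriorBalls (Ω : Set (E n)) (θ : ℝ) : Prop :=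
  ∀ z ∉ Ω, ∀ s : ℝ, 0 < s → ∃ y, Metric.ball y (θ * s) ⊆ Metric.ball z s ∩ Ωᶜ

/-- The proportion of a cube over which a local mean is taken. -/
noncomputable def meanRatio (n : ℕ) (θ : ℝ) : ℝ :=
  min 1 ((θ * (1 / 8)) ^ n * volume.real (Metric.ball (0 : E n) 1))

lemma meanRatio_pos (hθ : 0 < θ) : 0 < meanRatio n θ := by
  have : 0 < volume.real (Metric.ball (0 : E n) 1) :=
    ENNReal.toReal_pos (Metric.measure_ball_pos volume _ one_pos).ne' measure_ball_lt_top.ne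
  unfold meanRatio
  positivity

lemma volumeReal_cube (x : E n) {s : ℝ} (hs : 0 ≤ s) : volume.real (cube x s) = s ^ n := by
  rw [measureReal_def, volume_cube x hs, ENNReal.toReal_ofReal (by positivity)]

lemma volume_cube_ne_top (x : E n) {s : ℝ} (hs : 0 ≤ s) : volume (cube x s) ≠ ⊤ := by
  rw [volume_cube x hs]
  exact ENNReal.ofReal_ne_top

/-- Every local mean is a mean over a subset of proportional measure. -/
lemma exists_localMean_eq_average (hθ : 0 < θ) (hΩ : HasExteriorBalls Ω θ)
    (hu : ∀ᵐ x, x ∉ Ω → u x = 0) (x : E n) {s : ℝ} (hs : 0 < s) :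
    ∃ A ⊆ cube x s, meanRatio n θ * s ^ n ≤ volume.real A ∧
      localMean Ω u x s = ⨍ y in A, u y := by
  by_cases h : cube x (3 / 4 * s) ⊆ Ω
  · refine ⟨cube x s, Subset.rfl, ?_, if_pos h⟩
    rw [volumeReal_cube x hs.le]
    exact mul_le_of_le_one_left (by positivity) (min_le_left _ _)
  · obtain ⟨z, hz, hzΩ⟩ := not_subset.1 h
    -- The gap between the half sides of the cubes of side `3s/4` and `s` is `s/8`.
    obtain ⟨y, hy⟩ := hΩ z hzΩ (1 / 8 * s) (by positivity)
    refine ⟨Metric.ball y (θ * (1 / 8 * s)), fun w hw => ?_, ?_, ?_⟩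
    · have hw' := mem_ball_iff_norm.1 (hy hw).1
      exact mem_cube_of_near (d := 1 / 8 * s) hz
        (fun i => (abs_coord_le_norm (w - z) i).trans hw'.le) (by linarith)
    · rw [measureReal_def, Measure.addHaar_ball_of_pos _ _ (by positivity), ENNReal.toReal_mul,
        ENNReal.toReal_ofReal (by positivity), finrank_euclideanSpace_fin, ← measureReal_def]
      calc meanRatio n θ * s ^ n
          ≤ ((θ * (1 / 8)) ^ n * volume.real (Metric.ball (0 : E n) 1)) * s ^ n := by
            gcongr
            exact min_le_right _ _
        _ = _ := by rw [← mul_assoc θ, mul_pow (θ * (1 / 8)) s]; ring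
    -- The prescribed value `0` is the mean over the exterior ball, where `u` vanishes almost
    -- everywhere.
    · rw [localMean, if_neg h, setAverage_eq]
      have : ∫ w in Metric.ball y (θ * (1 / 8 * s)), u w = 0 := by
        refine setIntegral_eq_zero_of_ae_eq_zero ?_
        filter_upwards [hu] with w hw hwA
        exact hw (hy hwA).2
      rw [this, smul_zero]

/-- The constant in the Poincaré inequality for local means. -/
noncomputable def poincareConst (n : ℕ) (θ : ℝ) : ℝ := (meanRatio n θ)⁻¹ * 2 ^ n * n

lemma poincareConst_nonneg (hθ : 0 < θ) : 0 ≤ poincareConst n θ := by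
  have := meanRatio_pos (n := n) hθ
  unfold poincareConst
  positivity

lemma setIntegral_abs_sub_localMean_le (hθ : 0 < θ) (hΩ : HasExteriorBalls Ω θ)
    (hui : Integrable u) (hu : ∀ᵐ x, x ∉ Ω → u x = 0) {μ : VectorMeasure (E n) (E n)}
    (hμ : IsDistribGrad u μ) (x : E n) {s : ℝ} (hs : 0 < s) :
    ∫ y in cube x s, |u y - localMean Ω u x s| ≤
      poincareConst n θ * s * μ.variation.real (cube x (4 * s)) := by
  obtain ⟨A, hA, hvol, hm⟩ := exists_localMean_eq_average hθ hΩ hu x hs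
  rw [hm]
  exact setIntegral_abs_sub_average_le hui hμ x hs (meanRatio_pos hθ) hA hvol

/-- A crude bound without derivatives, from which the integrability of the truncation is obtained.
-/
lemma setIntegral_abs_sub_localMean_le_two_mul (hui : Integrable u) (x : E n) {s : ℝ}
    (hs : 0 < s) :
    ∫ y in cube x s, |u y - localMean Ω u x s| ≤ 2 * ∫ y in cube x s, |u y| := by
  have hfin := volume_cube_ne_top x hs.le
  have hI : 0 ≤ ∫ y in cube x s, |u y| := integral_nonneg fun y => abs_nonneg _
  have hm : s ^ n * |localMean Ω u x s| ≤ ∫ y in cube x s, |u y| := by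
    by_cases h : cube x (3 / 4 * s) ⊆ Ω
    · rw [localMean, if_pos h, setAverage_eq, volumeReal_cube x hs.le, smul_eq_mul, abs_mul,
        abs_of_pos (by positivity : 0 < (s ^ n)⁻¹), mul_inv_cancel_left₀ (by positivity)]
      exact abs_integral_le_integral_abs
    · rw [localMean, if_neg h]
      simpa using hI
  calc ∫ y in cube x s, |u y - localMean Ω u x s|
      ≤ ∫ y in cube x s, (|u y| + |localMean Ω u x s|) := by
        refine integral_mono (hui.integrableOn.sub (integrableOn_const hfin)).norm
          (hui.abs.integrableOn.add (integrableOn_const hfin)) fun y => abs_sub _ _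
    _ = (∫ y in cube x s, |u y|) + s ^ n * |localMean Ω u x s| := by
        rw [integral_add hui.abs.integrableOn (integrableOn_const hfin), setIntegral_const,
          volumeReal_cube x hs.le, smul_eq_mul]
    _ ≤ _ := by linarith

/-! ### The truncation -/

lemma integrable_cutoff (hui : Integrable u) (hP : IsWhitneyPartition K O a r η) (j : ι) (m : ℝ) :
    Integrable fun y => η j y * (u y - m) := by
  simpa only [mul_comm] using
    integrable_sub_const_mul hui m (hP.smooth j).continuous (hP.hasCompactSupport j)

lemma integrable_localCorrection (hφ : IsMollifier φ) (ht : 0 < t) (hui : Integrable u)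
    (hW : IsWhitneyCover O a r) (hP : IsWhitneyPartition K O a r η) (j : ι) :
    Integrable (localCorrection Ω φ t (a j) (r j) (η j) u) :=
  (integrable_cutoff hui hP j _).sub
    ((isKernel_cube hφ ht hW j).integrable_convolution (integrable_cutoff hui hP j _))

/-- One factor `2` comes from subtracting the local mean, the other from the mollified term, whose
`L¹` norm is no larger than that of the original. -/
lemma integral_norm_localCorrection_le (hφ : IsMollifier φ) (ht : 0 < t) (hui : Integrable u)
    (hW : IsWhitneyCover O a r) (hP : IsWhitneyPartition K O a r η) (j : ι) :
    ∫ x, ‖localCorrection Ω φ t (a j) (r j) (η j) u x‖ ≤ 4 * ∫ x in cube (a j) (r j), |u x| := by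
  have hf := integrable_cutoff hui hP j (localMean Ω u (a j) (r j))
  have hκ := isKernel_cube hφ ht hW j
  have hr := hW.pos j
  have h1 : ∫ x, ‖η j x * (u x - localMean Ω u (a j) (r j))‖ ≤
      2 * ∫ x in cube (a j) (r j), |u x| := by
    refine le_trans ?_ (setIntegral_abs_sub_localMean_le_two_mul (Ω := Ω) hui (a j) hr)
    rw [← integral_indicator (measurableSet_cube _ _)]
    refine integral_mono hf.norm ((integrable_indicator_iff (measurableSet_cube _ _)).2
      (hui.integrableOn.sub (integrableOn_const (volume_cube_ne_top _ hr.le))).norm) fun x => ?_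
    by_cases hx : x ∈ cube (a j) (r j)
    · simp only [indicator_of_mem hx, norm_mul, Real.norm_eq_abs, abs_of_nonneg (hP.nonneg j x)]
      exact mul_le_of_le_one_left (abs_nonneg _) (hP.le_one j x)
    · have : η j x = 0 := hP.eq_zero j fun h => hx (cube_mono _ (by linarith) h)
      simp [hx, this]
  calc ∫ x, ‖localCorrection Ω φ t (a j) (r j) (η j) u x‖
      ≤ ∫ x, (‖η j x * (u x - localMean Ω u (a j) (r j))‖ +
          ‖mollify φ t (r j) (fun y => η j y * (u y - localMean Ω u (a j) (r j))) x‖) :=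
        integral_mono (integrable_localCorrection hφ ht hui hW hP j).norm
          (hf.norm.add (hκ.integrable_convolution hf).norm) fun x => norm_sub_le _ _
    _ ≤ (∫ x, ‖η j x * (u x - localMean Ω u (a j) (r j))‖) +
          ∫ x, ‖η j x * (u x - localMean Ω u (a j) (r j))‖ := by
        exact (integral_add hf.norm (hκ.integrable_convolution hf).norm).trans_le
          (add_le_add_right (hκ.integral_norm_convolution_le hf) _)
    _ ≤ _ := by linarith

lemma summable_integral_norm_localCorrection [Countable ι] (hφ : IsMollifier φ) (ht : 0 < t)
    (hui : Integrable u) (hW : IsWhitneyCover O a r) (hP : IsWhitneyPartition K O a r η) :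
    Summable fun j => ∫ x, ‖localCorrection Ω φ t (a j) (r j) (η j) u x‖ := by
  -- For this finite measure the bounded overlap of the cubes is exactly the required summability.
  let ν : Measure (E n) := volume.withDensity fun x => ‖u x‖ₑ
  have hν : IsFiniteMeasure ν := ⟨by
    simpa only [ν, withDensity_apply _ MeasurableSet.univ, Measure.restrict_univ] using hasFiniteIntegral_iff_enorm.1 hui.2⟩
  refine Summable.of_nonneg_of_le (fun j => integral_nonneg fun x => norm_nonneg _) (fun j => ?_)
    ((hW.summable_measureReal ν).1.mul_left 4)
  refine (integral_norm_localCorrection_le hφ ht hui hW hP j).trans ?_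
  gcongr
  have hm := measurableSet_cube (a j) (4 * r j)
  have e : ν.real (cube (a j) (4 * r j)) = ∫ x in cube (a j) (4 * r j), ‖u x‖ := by
    rw [measureReal_def, withDensity_apply _ hm,
      integral_norm_eq_lintegral_enorm hui.aestronglyMeasurable.restrict]
  rw [e]
  exact setIntegral_mono_set hui.abs.integrableOn (ae_of_all _ fun x => abs_nonneg _)
    (cube_mono _ (by linarith [hW.pos j])).eventuallyLE

/-- As `t ≤ 1`, mollifying spreads the support by at most `r_j / 4`, which keeps it inside the cubes
with bounded overlap; the sum is therefore locally a finite one at each point. -/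
lemma localCorrection_eq_zero (hφ : IsMollifier φ) (ht : 0 < t) (ht1 : t ≤ 1)
    (hW : IsWhitneyCover O a r) (hP : IsWhitneyPartition K O a r η) (j : ι) {x : E n}
    (hx : x ∉ cube (a j) (4 * r j)) : localCorrection Ω φ t (a j) (r j) (η j) u x = 0 := by
  have hr := hW.pos j
  have h1 : η j x = 0 := hP.eq_zero j fun h => hx (cube_mono _ (by linarith) h)
  have h2 := (isKernel_cube hφ ht hW j).convolution_eq_zero
    (g := fun y => η j y * (u y - localMean Ω u (a j) (r j))) (x := x) fun y hy => by
      rw [hP.eq_zero j, zero_mul]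
      intro h
      refine hx (mem_cube_of_near (d := 1 / 4 * r j) h (fun i => ?_) (by linarith))
      have e : x i - (x - y) i = y i := by simp
      rw [e]
      refine (abs_coord_le_norm y i).trans (hy.trans ?_)
      nlinarith
  rw [localCorrection, h1, zero_mul, zero_sub, mollify, h2, neg_zero]

lemma summable_localCorrection (hφ : IsMollifier φ) (ht : 0 < t) (ht1 : t ≤ 1)
    (hW : IsWhitneyCover O a r) (hP : IsWhitneyPartition K O a r η) (x : E n) :
    Summable fun j => localCorrection Ω φ t (a j) (r j) (η j) u x := by
  refine summable_of_hasFiniteSupport ((hW.finite_overlap x).subset fun j hj => ?_)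
  by_contra h
  exact hj (localCorrection_eq_zero hφ ht ht1 hW hP j h)

lemma integrable_truncation [Countable ι] (hφ : IsMollifier φ) (ht : 0 < t) (ht1 : t ≤ 1)
    (hui : Integrable u) (hW : IsWhitneyCover O a r) (hP : IsWhitneyPartition K O a r η) :
    Integrable (truncation Ω φ t a r η u) := by
  have hB := fun j => integrable_localCorrection (Ω := Ω) hφ ht hui hW hP j
  refine hui.sub ⟨aestronglyMeasurable_of_tendsto_ae atTop
    (fun s => (s.aestronglyMeasurable_fun_sum fun j _ => (hB j).aestronglyMeasurable))
    (ae_of_all _ fun x => (summable_localCorrection hφ ht ht1 hW hP x).hasSum), ?_⟩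
  have hS := summable_integral_norm_localCorrection (Ω := Ω) hφ ht hui hW hP
  calc ∫⁻ x, ‖∑' j, localCorrection Ω φ t (a j) (r j) (η j) u x‖ₑ
      ≤ ∫⁻ x, ∑' j, ‖localCorrection Ω φ t (a j) (r j) (η j) u x‖ₑ :=
        lintegral_mono fun x => enorm_tsum_le_tsum_enorm
    _ = ∑' j, ENNReal.ofReal (∫ x, ‖localCorrection Ω φ t (a j) (r j) (η j) u x‖) := by
        rw [lintegral_tsum fun j => (hB j).aestronglyMeasurable.enorm]
        exact tsum_congr fun j => (ofReal_integral_norm_eq_lintegral_enorm (hB j)).symm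
    _ < ⊤ := by
        rw [← ENNReal.ofReal_tsum_of_nonneg (fun j => integral_nonneg fun x => norm_nonneg _) hS]
        exact ENNReal.ofReal_lt_top

/-- The constant in the commutator estimate on a single cube. -/
noncomputable def commutatorConst (n : ℕ) (θ K : ℝ) : ℝ := |K| / 4 * (1 + poincareConst n θ)

lemma commutatorConst_nonneg (hθ : 0 < θ) : 0 ≤ commutatorConst n θ K := by
  have := poincareConst_nonneg (n := n) hθ
  unfold commutatorConst
  positivity

/-- The scales balance: the radius `t r_j / 4` meets `|K| / r_j` on the variation, and `|K| / r_j²`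
on an integral for which Poincaré supplies another `r_j`. -/
lemma abs_commutator_le (hθ : 0 < θ) (hΩ : HasExteriorBalls Ω θ) (hφ : IsMollifier φ) (ht : 0 < t)
    (hui : Integrable u) (hu : ∀ᵐ x, x ∉ Ω → u x = 0) {μ : VectorMeasure (E n) (E n)}
    (hμ : IsDistribGrad u μ) (hW : IsWhitneyCover O a r) (hP : IsWhitneyPartition K O a r η) (j : ι)
    {ψ : E n → E n} (h1 : ContDiff ℝ 1 ψ) (h2 : HasCompactSupport ψ) {C : ℝ}
    (hC : ∀ x, ‖ψ x‖ ≤ C) :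
    |∫ x, (u x - localMean Ω u (a j) (r j)) *
        fderiv ℝ (η j) x (defect (rescale φ (t * (1 / 4) * r j)) ψ x)| ≤
      t * commutatorConst n θ K * C * μ.variation.real (cube (a j) (4 * r j)) := by
  have hr := hW.pos j
  have hC0 : 0 ≤ C := (norm_nonneg _).trans (hC 0)
  have hts := hP.tsupport_subset hW j
  have hη1 : ∀ x ∉ cube (a j) (r j), fderiv ℝ (η j) x = 0 := fun x hx =>
    image_eq_zero_of_notMem_tsupport fun h => hx (hts (tsupport_fderiv_subset ℝ h))
  have hη2 : ∀ x ∉ cube (a j) (r j), fderiv ℝ (fderiv ℝ (η j)) x = 0 := fun x hx =>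
    image_eq_zero_of_notMem_tsupport fun h =>
      hx (hts (tsupport_fderiv_subset ℝ (tsupport_fderiv_subset ℝ h)))
  refine (abs_integral_fderiv_cutoff_le (isKernel_cube hφ ht hW j) (by positivity) hui hμ _
    (hP.contDiff_two j) (hP.hasCompactSupport j) (measurableSet_cube (a j) (r j))
    (volume_cube_ne_top _ hr.le) hη1 hη2 (fun x => (hP.norm_fderiv_le hW j x).trans
      (div_le_div_of_nonneg_right (le_abs_self K) hr.le))
    (fun x => (hP.norm_fderiv_fderiv_le hW j x).trans
      (div_le_div_of_nonneg_right (le_abs_self K) (by positivity))) h1 h2 hC).trans ?_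
  have hp := setIntegral_abs_sub_localMean_le hθ hΩ hui hu hμ (a j) hr
  have hmono : μ.variation.real (cube (a j) (r j)) ≤ μ.variation.real (cube (a j) (4 * r j)) :=
    measureReal_mono (cube_mono _ (by linarith))
  calc _ ≤ t * (1 / 4) * r j * (|K| / r j * μ.variation.real (cube (a j) (4 * r j)) + |K| / r j ^ 2 *
          (poincareConst n θ * r j * μ.variation.real (cube (a j) (4 * r j)))) * C := by gcongr
    _ = _ := by
        unfold commutatorConst
        field_simp

/-- The commutator estimate for smooth fields. -/
lemma abs_integral_truncation_add_pairing_le [Countable ι] (hθ : 0 < θ)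
    (hΩ : HasExteriorBalls Ω θ) (hφ : IsMollifier φ) (ht : 0 < t) (ht1 : t ≤ 1)
    (hui : Integrable u) (hu : ∀ᵐ x, x ∉ Ω → u x = 0) {μ : VectorMeasure (E n) (E n)}
    (hμ : IsDistribGrad u μ) (hW : IsWhitneyCover O a r) (hP : IsWhitneyPartition K O a r η)
    {ψ : E n → E n} (h1 : ContDiff ℝ 1 ψ) (h2 : HasCompactSupport ψ) {C : ℝ}
    (hC : ∀ x, ‖ψ x‖ ≤ C) :
    |(-∫ x, truncation Ω φ t a r η u x * divergence ψ x) - pairing μ (almostDual φ t r η ψ)| ≤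
      t * commutatorConst n θ K * C * (120 ^ n * μ.variation.real O) := by
  have hC0 : 0 ≤ C := (norm_nonneg _).trans (hC 0)
  have hB := fun j => integrable_localCorrection (Ω := Ω) hφ ht hui hW hP j
  have hS := summable_integral_norm_localCorrection (Ω := Ω) hφ ht hui hW hP
  have hd := continuous_divergence h1
  obtain ⟨D, hD⟩ := (hasCompactSupport_divergence h2).exists_bound_of_continuous hd
  have hBd : ∀ j, Integrable fun x =>
      localCorrection Ω φ t (a j) (r j) (η j) u x * divergence ψ x := fun j =>
    (hB j).mul_bdd hd.aestronglyMeasurable (ae_of_all _ hD)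
  -- Summability of the `L¹` norms and boundedness of `div ψ` allow the sum and the integral to be
  -- exchanged.
  have hsum := hasSum_integral_of_summable_integral_norm hBd (by
    refine Summable.of_nonneg_of_le (fun j => integral_nonneg fun x => norm_nonneg _) (fun j => ?_)
      (hS.mul_right D)
    rw [← integral_mul_const]
    refine integral_mono (hBd j).norm ((hB j).norm.mul_const D) fun x => ?_
    simp only [norm_mul]
    exact mul_le_mul_of_nonneg_left (hD x) (norm_nonneg _))
  simp only [tsum_mul_right] at hsum
  have hT : ∫ x, truncation Ω φ t a r η u x * divergence ψ x =
      (∫ x, u x * divergence ψ x) -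
        ∫ x, (∑' j, localCorrection Ω φ t (a j) (r j) (η j) u x) * divergence ψ x := by
    have hI : Integrable fun x => ∑' j, localCorrection Ω φ t (a j) (r j) (η j) u x := by
      refine (hui.sub (integrable_truncation (Ω := Ω) hφ ht ht1 hui hW hP)).congr
        (ae_of_all _ fun x => ?_)
      simp only [Pi.sub_apply, truncation, sub_sub_cancel]
    rw [← integral_sub (hui.mul_bdd hd.aestronglyMeasurable (ae_of_all _ hD))
      (hI.mul_bdd hd.aestronglyMeasurable (ae_of_all _ hD))]
    simp only [truncation, sub_mul]
  set e : ι → ℝ := fun j => ∫ x, (u x - localMean Ω u (a j) (r j)) *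
        fderiv ℝ (η j) x (defect (rescale φ (t * (1 / 4) * r j)) ψ x) with he
  have hj : ∀ j, ∫ x, localCorrection Ω φ t (a j) (r j) (η j) u x * divergence ψ x =
      -pairing μ (fun x => η j x • defect (rescale φ (t * (1 / 4) * r j)) ψ x) - e j := fun j =>
    integral_correction_mul_divergence (isKernel_cube hφ ht hW j) hui hμ _ (hP.contDiff_two j)
      (hP.hasCompactSupport j) h1 h2
  simp only [hj] at hsum
  have hp := hasSum_pairing_defect hφ ht hW hP h1.continuous h2 μ
  -- Adding the two series cancels the pairings cube by cube, and only the errors `e j` remain.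
  have hesum := (hsum.add hp).neg
  have hfun : (fun j => -(-pairing μ (fun x => η j x • defect (rescale φ (t * (1 / 4) * r j)) ψ x) -
      e j + pairing μ fun x => η j x • defect (rescale φ (t * (1 / 4) * r j)) ψ x)) = e := by
    funext j
    ring
  rw [hfun] at hesum
  have hm := hW.summable_measureReal μ.variation
  have hbd := tsum_of_norm_bounded (f := e) (hm.1.mul_left (t * commutatorConst n θ K * C)).hasSum fun j =>
    abs_commutator_le hθ hΩ hφ ht hui hu hμ hW hP j h1 h2 hC
  rw [hesum.tsum_eq, hμ ψ h1 h2, tsum_mul_left, Real.norm_eq_abs, abs_neg] at hbd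
  rw [hT]
  refine (le_of_eq ?_).trans (hbd.trans ?_)
  · congr 1
    ring
  · have := commutatorConst_nonneg (n := n) (K := K) hθ
    gcongr
    exact hm.2

end LipTrunc

namespace LipTrunc

variable {n : ℕ} {O Ω : Set (E n)} {ι : Type} {a : ι → E n} {r : ι → ℝ} {η : ι → E n → ℝ} {K : ℝ}
  {φ : E n → ℝ} {t : ℝ} {u : E n → ℝ} {θ : ℝ}

/-! ### Bounded variation of the truncation and the commutator estimate -/

/-- For `C¹` fields bounded by one, the pairing of `μ` with the almost dual field is at most the
total variation of `μ`, and the commutator estimate controls the difference. -/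
lemma isBV_truncation [Countable ι] (hθ : 0 < θ) (hΩ : HasExteriorBalls Ω θ)
    (hφ : IsMollifier φ) (ht : 0 < t) (ht1 : t ≤ 1) (hui : Integrable u)
    (hu : ∀ᵐ x, x ∉ Ω → u x = 0) {μ : VectorMeasure (E n) (E n)} (hμ : IsDistribGrad u μ)
    (hW : IsWhitneyCover O a r) (hP : IsWhitneyPartition K O a r η) :
    IsBV (truncation Ω φ t a r η u) := by
  refine ⟨integrable_truncation hφ ht ht1 hui hW hP, μ.variation.real univ +
    t * commutatorConst n θ K * 1 * (120 ^ n * μ.variation.real O), ?_⟩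
  rintro _ ⟨ψ, h1, h2, h3, rfl⟩
  have hc := abs_le.1 <| abs_integral_truncation_add_pairing_le hθ hΩ hφ ht ht1 hui hu hμ hW hP
    h1 h2 h3
  have hp := abs_le.1 <| abs_pairing_le_univ (μ := μ) fun x =>
    norm_almostDual_le hφ ht hW hP (ae_of_all _ h3) (h3 x)
  linarith [hc.1, hp.1]

/-- The commutator estimate for continuous fields. -/
lemma abs_pairing_truncation_sub_pairing_almostDual_le [Countable ι] (hθ : 0 < θ)
    (hΩ : HasExteriorBalls Ω θ) (hφ : IsMollifier φ) (ht : 0 < t) (ht1 : t ≤ 1)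
    (hui : Integrable u) (hu : ∀ᵐ x, x ∉ Ω → u x = 0) {μ ν : VectorMeasure (E n) (E n)}
    (hμ : IsDistribGrad u μ) (hν : IsDistribGrad (truncation Ω φ t a r η u) ν)
    (hW : IsWhitneyCover O a r) (hP : IsWhitneyPartition K O a r η) {ρ : E n → E n}
    (h1 : Continuous ρ) (h2 : HasCompactSupport ρ) {C : ℝ} (hC : ∀ x, ‖ρ x‖ ≤ C) :
    |pairing ν ρ - pairing μ (almostDual φ t r η ρ)| ≤
      t * commutatorConst n θ K * C * (120 ^ n * μ.variation.real O) := by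
  set B := t * commutatorConst n θ K
  set m := 120 ^ n * μ.variation.real O
  have key : ∀ δ : ℝ, 0 < δ → |pairing ν ρ - pairing μ (almostDual φ t r η ρ)| ≤
      B * (C + δ) * m + δ * ν.variation.real univ + δ * μ.variation.real univ := by
    intro δ hδ
    -- A `C¹` field uniformly `δ`-close to `ρ` and with support inside that of `ρ`. Each pairing
    -- changes by at most `δ` times a finite total variation, as the almost dual operator is linear
    -- and does not increase the sup norm.
    obtain ⟨ψ, hψ, hψd, hψs⟩ :=
      h1.exists_contDiff_approx 1 (continuous_const (y := δ)) fun _ => hδ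
    have hψc : HasCompactSupport ψ := h2.mono hψs
    have hdiff : ∀ x, ‖ρ x - ψ x‖ ≤ δ := fun x => by
      rw [← dist_eq_norm, dist_comm]
      exact (hψd x).le
    have hψC : ∀ x, ‖ψ x‖ ≤ C + δ := fun x => by
      have := norm_sub_rev (ρ x) (ψ x) ▸ norm_le_norm_add_norm_sub' (ψ x) (ρ x)
      linarith [hC x, hdiff x]
    have int : ∀ σ : E n → E n, Continuous σ → HasCompactSupport σ → Integrable σ ν.variation :=
      fun σ h h' => h.integrable_of_hasCompactSupport h'
    have e1 := pairing_sub (int ρ h1 h2) (int ψ hψ.continuous hψc)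
    have e2 := pairing_sub (integrable_almostDual hφ ht hW hP h1 h2 μ.variation)
      (integrable_almostDual hφ ht hW hP hψ.continuous hψc μ.variation)
    have b1 := abs_le.1 <| abs_pairing_le_univ (μ := ν) hdiff
    have b2 := abs_le.1 <| abs_pairing_le_univ (μ := μ) fun x =>
      norm_almostDual_le hφ ht hW hP (ae_of_all _ hdiff) (hdiff x)
    simp only [almostDual_sub hφ ht hW hP h1 h2 hψ.continuous hψc] at b2
    have b3 := abs_le.1 <| abs_integral_truncation_add_pairing_le hθ hΩ hφ ht ht1 hui hu hμ hW hP
      hψ hψc hψC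
    rw [← hν ψ hψ hψc] at b3
    rw [e1] at b1
    rw [e2] at b2
    rw [abs_le]
    constructor <;> linarith [b1.1, b1.2, b2.1, b2.2, b3.1, b3.2]
  have hlim : Tendsto (fun δ : ℝ => B * (C + δ) * m + δ * ν.variation.real univ +
      δ * μ.variation.real univ) (𝓝[>] 0) (𝓝 (B * C * m)) := by
    have : Continuous fun δ : ℝ => B * (C + δ) * m + δ * ν.variation.real univ +
      δ * μ.variation.real univ := by fun_prop
    simpa using (this.tendsto 0).mono_left nhdsWithin_le_nhds
  exact ge_of_tendsto hlim (eventually_mem_nhdsWithin.mono fun δ hδ => key δ hδ)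

/-- Continuity upgrades the almost everywhere bound to every point, as required because the gradient
measure may charge Lebesgue null sets. -/
lemma norm_le_toReal_eLpNorm_top {ρ : E n → E n} (h1 : Continuous ρ) (h2 : HasCompactSupport ρ)
    (x : E n) : ‖ρ x‖ ≤ (eLpNorm ρ ⊤ volume).toReal := by
  have hfin : eLpNorm ρ ⊤ volume ≠ ⊤ := (h1.memLp_top_of_hasCompactSupport h2 _).2.ne
  have hC : ∀ᵐ x, ‖ρ x‖ ≤ (eLpNorm ρ ⊤ volume).toReal := by
    filter_upwards [ae_le_eLpNormEssSup (f := ρ) (μ := volume)] with x hx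
    rw [← eLpNorm_exponent_top] at hx
    simpa only [toReal_enorm] using ENNReal.toReal_mono hfin hx
  exact (isClosed_le h1.norm continuous_const).closure_subset_iff.2 subset_rfl
    (Measure.dense_of_ae hC x)

lemma exists_hasExteriorBalls (hn : 0 < n) (hΩ : Ω = univ ∨ IsBoundedLipschitz Ω) :
    ∃ θ : ℝ, 0 < θ ∧ HasExteriorBalls Ω θ := by
  rcases hΩ with rfl | hΩ
  · exact ⟨1, one_pos, fun z hz => absurd (mem_univ z) hz⟩
  · obtain ⟨κ, hκ, -, h⟩ := hΩ.exists_exterior_ball hn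
    exact ⟨κ, hκ, h⟩

end LipTrunc

/-! ### The commutator-type estimate. -/

theorem lemma3p6 (n : ℕ) (hn : 2 ≤ n) (Ω : Set (LipTrunc.E n))
    (hΩ : Ω = Set.univ ∨ LipTrunc.IsBoundedLipschitz Ω) (K : ℝ) :
    ∃ c : ℝ, 0 < c ∧
      ∀ (φ : LipTrunc.E n → ℝ), LipTrunc.IsMollifier φ →
      ∀ (h : ℝ → ℝ), (∀ t, 0 < t → 0 < h t ∧ h t ≤ 1) → AntitoneOn h (Set.Ioi 0) →
        Tendsto h atTop (𝓝 0) →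
      ∀ (lam : ℝ), 0 < lam →
      ∀ (u : LipTrunc.E n → ℝ), LipTrunc.IsBV u →
      ∀ (ι : Type) [Countable ι] (a : ι → LipTrunc.E n) (r : ι → ℝ)
        (η : ι → LipTrunc.E n → ℝ),
        LipTrunc.IsWhitneyCover (LipTrunc.badSet u lam) a r →
        LipTrunc.IsWhitneyPartition K (LipTrunc.badSet u lam) a r η →
        (∀ ρ : LipTrunc.E n → LipTrunc.E n, Continuous ρ → HasCompactSupport ρ → tsupport ρ ⊆ Ω →
          eLpNorm (LipTrunc.almostDual φ (h lam) r η ρ) ⊤ volume ≤ eLpNorm ρ ⊤ volume) ∧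
        ((∀ᵐ x, x ∉ Ω → u x = 0) →
          LipTrunc.IsBV (LipTrunc.truncation Ω φ (h lam) a r η u) ∧
          ∀ ρ : LipTrunc.E n → LipTrunc.E n, Continuous ρ → HasCompactSupport ρ →
            tsupport ρ ⊆ Ω →
            ENNReal.ofReal
                |LipTrunc.pairing (LipTrunc.D (LipTrunc.truncation Ω φ (h lam) a r η u)) ρ
                  - LipTrunc.pairing (LipTrunc.D u) (LipTrunc.almostDual φ (h lam) r η ρ)|
              ≤ ENNReal.ofReal (c * h lam)
                * (LipTrunc.D u).variation (LipTrunc.badSet u lam) * eLpNorm ρ ⊤ volume) := by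
  obtain ⟨θ, hθ, hext⟩ := LipTrunc.exists_hasExteriorBalls (by omega) hΩ
  have hc0 := LipTrunc.commutatorConst_nonneg (n := n) (K := K) hθ
  -- The summand `1` keeps the constant positive even when `K = 0`.
  refine ⟨LipTrunc.commutatorConst n θ K * 120 ^ n + 1, by positivity, ?_⟩
  intro φ hφ h hh _ _ lam hlam u hu ι _ a r η hW hP
  obtain ⟨ht, ht1⟩ := hh lam hlam
  refine ⟨fun ρ h1 h2 _ => LipTrunc.eLpNorm_almostDual_le hφ ht hW hP h1 h2, fun hu0 => ?_⟩
  have hBV := LipTrunc.isBV_truncation hθ hext hφ ht ht1 hu.1 hu0 hu.isDistribGrad hW hP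
  refine ⟨hBV, fun ρ h1 h2 _ => ?_⟩
  have hfin : eLpNorm ρ ⊤ volume ≠ ⊤ := (h1.memLp_top_of_hasCompactSupport h2 _).2.ne
  have hmain := LipTrunc.abs_pairing_truncation_sub_pairing_almostDual_le hθ hext hφ ht ht1 hu.1 hu0
    hu.isDistribGrad hBV.isDistribGrad hW hP h1 h2 (LipTrunc.norm_le_toReal_eLpNorm_top h1 h2)
  rw [← ofReal_measureReal (measure_ne_top (LipTrunc.D u).variation _), ← ENNReal.ofReal_toReal hfin,
    ← ENNReal.ofReal_mul (by positivity), ← ENNReal.ofReal_mul (by positivity)]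
  refine ENNReal.ofReal_le_ofReal (hmain.trans ?_)
  have : 0 ≤ h lam * (LipTrunc.D u).variation.real (LipTrunc.badSet u lam) *
    (eLpNorm ρ ⊤ volume).toReal := by positivity
  linarith
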